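/- Let $\mathcal X$ be a measurable space, $\mathcal Y$ a finite set of classes, $\Delta^{\mathcal Y}$ the simplex of probability vectors on $\mathcal Y$, $\ell\colon \Delta^{\mathcal Y}\times\mathcal Y\to[0,1]$ a loss function, and $\mathcal H$ a class of hypotheses $h\colon\mathcal X\to\Delta^{\mathcal Y}$ such that $(x,y)\mapsto\ell(h(x),y)$ is measurable for every $h\in\mathcal H$. For a distribution $\mathcal D$ on $\mathcal X\times\mathcal Y$ put $\mathcal L_{\mathcal D}(h)=\mathbb E_{(x,y)\sim\mathcal D}[\ell(h(x),y)]$. There are $p$ clients. Client $k$ draws $m_k$ samples i.i.d. from a distribution $\mathcal D_k$ on $\mathcal X\times\mathcal Y$, independently of the other clients; $\widehat{\mathcal D}_k$ is the empirical distribution of these samples, and $m=\sum_{k=1}^p m_k\ge 1$. (A client with $m_k=0$ has weight $0$ below.) Let $q\ge1$ be the number of clusters and $0<\delta<1$. Let $\mathcal F=\{(x,y)\mapsto\ell(h(x),y): h\in\mathcal H\}$. Assume that $\mathcal F$ is a measurable class, in the sense that for all $n$, all reals $e_1,\dots,e_n$ and all clients $k_1,\dots,k_n$ the map $(z_1,\dots,z_n)\mapsto\sup_{f\in\mathcal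 F}\sum_{i=1}^n e_i f(z_i)$ is measurable up to null sets of $\mathcal D_{k_1}\otimes\dots\otimes\mathcal D_{k_n}$. Let $d$ be the pseudo-dimension of $\mathcal F$, that is, the largest size of a set $\{z_1,\dots,z_d\}\subseteq\mathcal X\times\mathcal Y$ with thresholds $r_1,\dots,r_d\in\mathbb R$ such that every subset of $\{1,\dots,d\}$ equals $\{i: f(z_i)>r_i\}$ for some $f\in\mathcal F$. Assume that $d$ is finite and $d\le m$. Then, with probability at least $1-\delta$ over the samples, $$\sup_{h_1,\dots,h_q\in\mathcal H}\left|\sum_{k=1}^p\frac{m_k}{m}\left(\min_{i\in[q]}\mathcal L_{\mathcal D_k}(h_i)-\min_{i\in[q]}\mathcal L_{\widehat{\mathcal D}_k}(h_i)\right)\right|\le\sqrt{\frac{4p\log\frac{2q}{\delta}}{m}}+\sqrt{\frac{dq}{m}\log\frac{em}{d}},$$ where the last term is read as $0$ if $d=0$. In particular the bound depends on the sample sizes only through the average numbers $m/p$ and $m/q$ of samples per client and per cluster, not on $\min_k m_k$. -/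

import Mathlib

open MeasureTheory

noncomputable section

namespace ClusterGen

/-- A finite set `A` of points is pseudo-shattered by the class `F` of real functions: for one
choice of thresholds `r`, every subset `B` of `A` is cut out as `{z ∈ A | r z < f z}` by some
`f ∈ F`. -/
def PseudoShatters {Z : Type*} (F : Set (Z → ℝ)) (A : Finset Z) : Prop :=
  ∃ r : Z → ℝ, ∀ B : Finset Z, B ⊆ A → ∃ f ∈ F, ∀ z ∈ A, (r z < f z ↔ z ∈ B)

/-- The pseudo-dimension (in `ℕ ∪ {∞}`) of a class of real functions: the supremum of the sizes
of the finite sets which it pseudo-shatters. -/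
def pseudoDim {Z : Type*} (F : Set (Z → ℝ)) : ℕ∞ :=
  ⨆ A : {A : Finset Z // PseudoShatters F A}, (A.1.card : ℕ∞)

/-- The functions `(x, y) ↦ ℓ (h x, y)`, for `h` in the hypothesis class. -/
def lossClass {X Y : Type*} [Fintype Y] (ℓ : stdSimplex ℝ Y → Y → ℝ)
    (H : Set (X → stdSimplex ℝ Y)) : Set (X × Y → ℝ) :=
  (fun (h : X → stdSimplex ℝ Y) (z : X × Y) => ℓ (h z.1) z.2) '' H

/-- Measurability of a class of functions in the sense of empirical process theory, for samples
of independent points drawn from members of the family `D`: suprema over the class of finite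
weighted sums are measurable up to null sets. -/
def IsMeasurableClass {Z ι : Type*} [MeasurableSpace Z] (F : Set (Z → ℝ))
    (D : ι → Measure Z) : Prop :=
  ∀ (n : ℕ) (κ : Fin n → ι) (e : Fin n → ℝ),
    AEMeasurable (fun z : Fin n → Z => ⨆ f : F, ∑ i, e i * f.1 (z i))
      (Measure.pi fun i => D (κ i))

/-- The expected loss of the hypothesis `h` under the distribution `μ`. -/
def expLoss {X Y : Type*} [Fintype Y] [MeasurableSpace X] [MeasurableSpace Y]
    (ℓ : stdSimplex ℝ Y → Y → ℝ) (μ : Measure (X × Y)) (h : X → stdSimplex ℝ Y) : ℝ :=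
  ∫ z, ℓ (h z.1) z.2 ∂μ

/-- The empirical distribution of a sample of size `n`. -/
def empirical {Z : Type*} [MeasurableSpace Z] {n : ℕ} (s : Fin n → Z) : Measure Z :=
  (n : ENNReal)⁻¹ • ∑ i, Measure.dirac (s i)

/-- The law of the samples of all clients: client `k` draws `m k` points from `D k`, all points
being independent. -/
def sampleLaw {Z : Type*} [MeasurableSpace Z] {p : ℕ} (m : Fin p → ℕ)
    (D : Fin p → Measure Z) : Measure ((k : Fin p) → Fin (m k) → Z) :=
  Measure.pi fun k => Measure.pi fun _ : Fin (m k) => D k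

/-- The signed gap between the true and the empirical clustering loss of `h 0, …, h (q - 1)`,
where client `k` has the weight `m k / ∑ j, m j`. -/
def clusterGap {X Y : Type*} [Fintype Y] [MeasurableSpace X] [MeasurableSpace Y] {p q : ℕ}
    (ℓ : stdSimplex ℝ Y → Y → ℝ) (m : Fin p → ℕ) (D : Fin p → Measure (X × Y))
    (S : (k : Fin p) → Fin (m k) → X × Y) (h : Fin q → X → stdSimplex ℝ Y) : ℝ :=
  ∑ k, (m k : ℝ) / (∑ j, m j : ℕ) *
    ((⨅ i, expLoss ℓ (D k) (h i)) - ⨅ i, expLoss ℓ (empirical (S k)) (h i))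

end ClusterGen

end

/-!
Why the bound holds. Let `M` be the total sample size, `x = d * q / M`, and
`A = p * log (2 * q / δ)`.

Assigning to each client a cluster which is optimal for the empirical (or the true) loss bounds
the gap, or its negative, by a sum of deviations between true and empirical losses for this
assignment; a union over `q ^ p` assignments and two signs costs `log 2 + p * log q`, at most
`A + log δ` (`exists_assignment_abs_clusterGap_le`, `exists_measurableSet_clusterGap_le`). For a
fixed assignment an exponential moment of the supremum of these deviations is estimated with `c`
independent ghost copies of the sample (`exists_measurableSet_deviation_le`). The suprema over
sample and ghosts are the ones which the hypothesis on the class makes measurable; Jensen's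
inequality and Fubini's theorem avoid any measurability of suprema of true losses.

Permuting sample and ghosts within each client preserves the law, so for fixed points one may
average over a finite family of permutations, i.e. over the choice of the sample among the points.
Writing a function with values in `[0, 1]` as the average of the indicators of its level sets
`{f > u}` reduces the suprema to level sets (`sum_exp_iSup_le`). One tuple of functions, one per
cluster, cuts out a subset of the `(c + 1) * M` points; these subsets shatter no more than `d * q`
points, and the lemma of Sauer and Shelah bounds their number.

The constant `1` in front of `d * q / M * log (e * M / d)` is half of what one ghost per sample
point would give, so several ghosts are needed, in two regimes.

* For `x < 1 / 15` there are `c = 11` ghosts for each sample point; the sample point is chosen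
  uniformly among the twelve, and Hoeffding's lemma applies (`selectionBound_rows`).
* For `1 / 15 ≤ x < 1` Hoeffding's lemma is too weak. Here `c = 4`, and the sample of client `k`
  is a uniform subset of `m k` of the `5 * m k` points. A generating function with one variable
  `z` bounds the exponential moment by `(1 + z) ^ (5 * m k) / (z ^ m k * (5 * m k).choose (m k))`,
  for every index set (`selectionBound_subsets`). The binomial coefficient loses a factor
  `5 * m k + 1` for each client, which is absorbed, together with `A`, by the summand
  `√(4 * A / M)` of the bound. There remains an inequality between functions of `x` alone,
  `exists_logRate_le`: on three intervals a linear function of `x` is compared with the concave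
  function `√(x * (1 - log x))`, and the parameter is sent to infinity as `x` tends to `1`.

If the bound is at least `1` there is nothing to prove; in particular this is so for `x ≥ 1`.
-/

noncomputable section

namespace ClusterGen

/-! ### Combinatorics: counting level sets -/

/-- The Sauer–Shelah bound in the form of a weight: giving each subset `A` of `J` the weight
`s ^ |A|`, the total weight is `(1 + s) ^ |J|`, and each shattered set weighs at least `s ^ b`. -/
lemma card_mul_pow_le {J : Type*} [Fintype J] [DecidableEq J] (𝒜 : Finset (Finset J)) {b : ℕ}
    (h𝒜 : ∀ A, 𝒜.Shatters A → A.card ≤ b) {s : ℝ} (hs0 : 0 < s) (hs1 : s ≤ 1) :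
    (𝒜.card : ℝ) * s ^ b ≤ (1 + s) ^ Fintype.card J := by
  calc (𝒜.card : ℝ) * s ^ b ≤ 𝒜.shatterer.card * s ^ b := by
        exact mul_le_mul_of_nonneg_right (by exact_mod_cast 𝒜.card_le_card_shatterer) (by positivity)
    _ = ∑ _A ∈ 𝒜.shatterer, s ^ b := by simp
    _ ≤ ∑ A ∈ 𝒜.shatterer, s ^ A.card := by
        refine Finset.sum_le_sum fun A hA => ?_
        exact pow_le_pow_of_le_one hs0.le hs1 (h𝒜 A (Finset.mem_shatterer.1 hA))
    _ ≤ ∑ A ∈ (Finset.univ : Finset J).powerset, s ^ A.card := by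
        refine Finset.sum_le_sum_of_subset_of_nonneg (fun A _ => by simp) fun A _ _ => ?_
        positivity
    _ = (1 + s) ^ Fintype.card J := by
        have := Finset.prod_one_add (f := fun _ : J => s) Finset.univ
        simp only [Finset.prod_const, Finset.card_univ] at this
        exact this.symm

/-- Let the points `w j`, `j ∈ J`, be sorted into `q` clusters by `g`. The sets
`{j | u < f (g j) (w j)}`, with one function `f i` of the class for each cluster, shatter only sets
of at most `d * q` indices: in each cluster they cut out level sets of single functions. -/
lemma card_le_of_shatters_levelSets {Z J : Type*} [DecidableEq J] {q : ℕ} {F : Set (Z → ℝ)} {d : ℕ}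
    (hd : ∀ B : Finset Z, PseudoShatters F B → B.card ≤ d) (g : J → Fin q) (w : J → Z) (u : ℝ)
    {𝒜 : Finset (Finset J)}
    (h𝒜 : ∀ A ∈ 𝒜, ∃ f : Fin q → Z → ℝ, (∀ i, f i ∈ F) ∧ ∀ j, j ∈ A ↔ u < f (g j) (w j))
    {A : Finset J} (hA : 𝒜.Shatters A) : A.card ≤ d * q := by
  classical
  have key : ∀ i : Fin q, (A.filter (fun j => g j = i)).card ≤ d := by
    intro i
    set B := A.filter (fun j => g j = i) with hB
    have hBA : B ⊆ A := Finset.filter_subset _ _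
    -- on a shattered set within one cluster the points are distinct
    have hinj : Set.InjOn w (B : Set J) := by
      intro j hj j' hj' hjj
      have hj2 := Finset.mem_filter.1 (Finset.mem_coe.1 hj)
      have hj2' := Finset.mem_filter.1 (Finset.mem_coe.1 hj')
      obtain ⟨T, hT, hT'⟩ := hA (t := {j}) (by simpa using hj2.1)
      obtain ⟨f, -, hf⟩ := h𝒜 T hT
      have h1 : j ∈ T := by
        have : j ∈ A ∩ T := by rw [hT']; simp
        exact (Finset.mem_inter.1 this).2
      have h2 : j' ∈ T := by
        rw [hf, hj2'.2, ← hjj, ← hj2.2, ← hf]; exact h1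
      have h3 : j' ∈ A ∩ T := Finset.mem_inter.2 ⟨hj2'.1, h2⟩
      rw [hT'] at h3
      exact (Finset.mem_singleton.1 h3).symm
    rw [← Finset.card_image_of_injOn hinj]
    refine hd _ ⟨fun _ => u, fun C _ => ?_⟩
    obtain ⟨T, hT, hT'⟩ := hA (t := A.filter (fun j => w j ∈ C)) (Finset.filter_subset _ _)
    obtain ⟨f, hfF, hf⟩ := h𝒜 T hT
    refine ⟨f i, hfF i, fun z hz => ?_⟩
    obtain ⟨j, hj, rfl⟩ := Finset.mem_image.1 hz
    have hj2 := Finset.mem_filter.1 hj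
    have h1 := hf j
    rw [hj2.2] at h1
    rw [← h1]
    have h2 := Finset.ext_iff.1 hT' j
    simpa [hj2.1] using h2
  calc A.card = ∑ i : Fin q, (A.filter (fun j => g j = i)).card :=
        Finset.card_eq_sum_card_fiberwise (fun _ _ => Finset.mem_coe.2 (Finset.mem_univ _))
    _ ≤ ∑ _i : Fin q, d := Finset.sum_le_sum fun i _ => key i
    _ = d * q := by simp [mul_comm]

/-! ### From real-valued functions to level sets -/

lemma integral_indicator_lt {v : ℝ} (hv : v ∈ Set.Icc (0 : ℝ) 1) :
    ∫ u, (if u < v then (1 : ℝ) else 0) ∂(volume.restrict (Set.Icc (0 : ℝ) 1)) = v := by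
  have h : (fun u : ℝ => if u < v then (1 : ℝ) else 0) = (Set.Iio v).indicator 1 := by
    ext u; simp [Set.indicator]
  rw [h, integral_indicator_one measurableSet_Iio, measureReal_restrict_apply measurableSet_Iio]
  have h2 : Set.Iio v ∩ Set.Icc (0 : ℝ) 1 = Set.Ico 0 v := by
    ext u; simp only [Set.mem_inter_iff, Set.mem_Iio, Set.mem_Icc, Set.mem_Ico]
    constructor
    · rintro ⟨a, b, c⟩; exact ⟨b, a⟩
    · rintro ⟨a, b⟩; exact ⟨b, a, by linarith [hv.2]⟩
  rw [h2]; simp [hv.1]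

/-- A linear form in values `v j ∈ [0, 1]` is the average over `u ∈ [0, 1]` of its values at the
level sets `{j | u < v j}`; Jensen's inequality for `exp` lets one bound exponential averages
over values by exponential averages over sets. -/
lemma sum_exp_le_of_forall_levelSet {J Γ : Type*} [Fintype J] [Fintype Γ]
    (e v : Γ → J → ℝ) (hv : ∀ γ j, v γ j ∈ Set.Icc (0 : ℝ) 1) {C : ℝ}
    (hC : ∀ u : ℝ, ∑ γ, Real.exp (∑ j, e γ j * if u < v γ j then 1 else 0) ≤ C) :
    ∑ γ, Real.exp (∑ j, e γ j * v γ j) ≤ C := by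
  set μ : Measure ℝ := volume.restrict (Set.Icc (0 : ℝ) 1) with hμ
  have : IsProbabilityMeasure μ := ⟨by simp [hμ]⟩
  have hm : ∀ γ j, Measurable fun u : ℝ => e γ j * (if u < v γ j then (1 : ℝ) else 0) := by
    intro γ j
    exact (Measurable.ite measurableSet_Iio measurable_const measurable_const).const_mul _
  have hb : ∀ γ j (u : ℝ), |e γ j * (if u < v γ j then (1 : ℝ) else 0)| ≤ |e γ j| := by
    intro γ j u; split_ifs <;> simp
  have hi : ∀ γ j, Integrable (fun u : ℝ => e γ j * (if u < v γ j then (1 : ℝ) else 0)) μ :=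
    fun γ j => Integrable.of_bound (hm γ j).aestronglyMeasurable _
      (Filter.Eventually.of_forall fun u => by rw [Real.norm_eq_abs]; exact hb γ j u)
  have hi' : ∀ γ, Integrable
      (fun u : ℝ => Real.exp (∑ j, e γ j * (if u < v γ j then (1 : ℝ) else 0))) μ := by
    intro γ
    refine Integrable.of_bound (C := Real.exp (∑ j, |e γ j|)) ?_ ?_
    · exact (Real.measurable_exp.comp
        (Finset.measurable_sum _ fun j _ => hm γ j)).aestronglyMeasurable
    · refine Filter.Eventually.of_forall fun u => ?_
      rw [Real.norm_eq_abs, Real.abs_exp]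
      exact Real.exp_le_exp.2 (Finset.sum_le_sum fun j _ => (le_abs_self _).trans (hb γ j u))
  have step : ∀ γ, Real.exp (∑ j, e γ j * v γ j) ≤
      ∫ u, Real.exp (∑ j, e γ j * (if u < v γ j then (1 : ℝ) else 0)) ∂μ := by
    intro γ
    have h1 : ∑ j, e γ j * v γ j =
        ∫ u, ∑ j, e γ j * (if u < v γ j then (1 : ℝ) else 0) ∂μ := by
      rw [integral_finsetSum _ fun j _ => hi γ j]
      refine Finset.sum_congr rfl fun j _ => ?_
      rw [integral_const_mul, integral_indicator_lt (hv γ j)]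
    rw [h1]
    exact convexOn_exp.map_integral_le Real.continuous_exp.continuousOn isClosed_univ
      (Filter.Eventually.of_forall fun _ => Set.mem_univ _)
      (integrable_finsetSum _ fun j _ => hi γ j) (hi' γ)
  calc ∑ γ, Real.exp (∑ j, e γ j * v γ j)
      ≤ ∑ γ, ∫ u, Real.exp (∑ j, e γ j * (if u < v γ j then (1 : ℝ) else 0)) ∂μ :=
        Finset.sum_le_sum fun γ _ => step γ
    _ = ∫ u, ∑ γ, Real.exp (∑ j, e γ j * (if u < v γ j then (1 : ℝ) else 0)) ∂μ :=
        (integral_finsetSum _ fun γ _ => hi' γ).symm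
    _ ≤ ∫ _u, C ∂μ := integral_mono (integrable_finsetSum _ fun γ _ => hi' γ)
        (integrable_const _) hC
    _ = C := by simp

/-- For fixed points `w j`, the exponential average over `γ` of the suprema (one per cluster) of the
linear forms `e γ` over the class is controlled by the exponential averages over single index
sets `A`, up to the number of index sets that level sets can cut out. -/
theorem sum_exp_iSup_le {Z J Γ : Type*} [Fintype J] [Fintype Γ] {q : ℕ}
    {F : Set (Z → ℝ)} (hF : ∀ f ∈ F, ∀ z, f z ∈ Set.Icc (0 : ℝ) 1) (hne : F.Nonempty) {d : ℕ}
    (hd : ∀ B : Finset Z, PseudoShatters F B → B.card ≤ d) (g : J → Fin q) (w : J → Z)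
    (e : Γ → J → ℝ) {K : ℝ} (hK : ∀ A : Finset J, ∑ γ, Real.exp (∑ j ∈ A, e γ j) ≤ K)
    {s : ℝ} (hs0 : 0 < s) (hs1 : s ≤ 1) :
    ∑ γ, Real.exp (∑ i, ⨆ f : F, ∑ j, (if g j = i then e γ j else 0) * f.1 (w j)) ≤
      (1 + s) ^ Fintype.card J / s ^ (d * q) * K := by
  classical
  have hK0 : 0 ≤ K := (Finset.sum_nonneg fun _ _ => (Real.exp_pos _).le).trans (hK ∅)
  -- the bound for a choice of functions, one tuple for each `γ`
  have main : ∀ f : Γ → Fin q → Z → ℝ, (∀ γ i, f γ i ∈ F) →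
      ∑ γ, Real.exp (∑ j, e γ j * f γ (g j) (w j)) ≤
        (1 + s) ^ Fintype.card J / s ^ (d * q) * K := by
    intro f hf
    refine sum_exp_le_of_forall_levelSet e (fun γ j => f γ (g j) (w j))
      (fun γ j => hF _ (hf γ (g j)) _) fun u => ?_
    set 𝒯 : Finset (Finset J) := Finset.univ.filter fun A =>
      ∃ f : Fin q → Z → ℝ, (∀ i, f i ∈ F) ∧ ∀ j, j ∈ A ↔ u < f (g j) (w j) with h𝒯
    have hcard : (𝒯.card : ℝ) ≤ (1 + s) ^ Fintype.card J / s ^ (d * q) := by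
      rw [le_div_iff₀ (by positivity)]
      refine card_mul_pow_le 𝒯 (fun A hA => ?_) hs0 hs1
      exact card_le_of_shatters_levelSets hd g w u (fun A hA => (Finset.mem_filter.1 hA).2) hA
    calc ∑ γ, Real.exp (∑ j, e γ j * if u < f γ (g j) (w j) then 1 else 0)
        ≤ ∑ γ, ∑ A ∈ 𝒯, Real.exp (∑ j ∈ A, e γ j) := by
          refine Finset.sum_le_sum fun γ _ => ?_
          set A := Finset.univ.filter fun j => u < f γ (g j) (w j) with hA
          have hmem : A ∈ 𝒯 := by
            rw [h𝒯, Finset.mem_filter]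
            exact ⟨Finset.mem_univ _, f γ, hf γ, fun j => by simp [hA]⟩
          have heq : ∑ j, e γ j * (if u < f γ (g j) (w j) then (1 : ℝ) else 0) =
              ∑ j ∈ A, e γ j := by
            rw [hA, Finset.sum_filter]
            exact Finset.sum_congr rfl fun j _ => by split_ifs <;> simp
          rw [heq]
          exact Finset.single_le_sum (f := fun A => Real.exp (∑ j ∈ A, e γ j))
            (fun _ _ => (Real.exp_pos _).le) hmem
      _ = ∑ A ∈ 𝒯, ∑ γ, Real.exp (∑ j ∈ A, e γ j) := Finset.sum_comm
      _ ≤ ∑ _A ∈ 𝒯, K := Finset.sum_le_sum fun A _ => hK A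
      _ = 𝒯.card * K := by simp
      _ ≤ _ := by gcongr
  -- choose nearly optimal functions
  have approx : ∀ η : ℝ, 0 < η →
      ∑ γ, Real.exp (∑ i, ⨆ f : F, ∑ j, (if g j = i then e γ j else 0) * f.1 (w j)) ≤
        Real.exp (q * η) * ((1 + s) ^ Fintype.card J / s ^ (d * q) * K) := by
    intro η hη
    have : Nonempty F := hne.to_subtype
    have hex : ∀ (γ : Γ) (i : Fin q), ∃ f : F,
        (⨆ f : F, ∑ j, (if g j = i then e γ j else 0) * f.1 (w j)) - η <
          ∑ j, (if g j = i then e γ j else 0) * f.1 (w j) :=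
      fun γ i => exists_lt_of_lt_ciSup (by linarith)
    choose f hf using hex
    have h1 : ∀ γ, ∑ i, (⨆ f : F, ∑ j, (if g j = i then e γ j else 0) * f.1 (w j)) ≤
        q * η + ∑ j, e γ j * (f γ (g j)).1 (w j) := by
      intro γ
      have h2 : ∑ j, e γ j * (f γ (g j)).1 (w j) =
          ∑ i, ∑ j, (if g j = i then e γ j else 0) * (f γ i).1 (w j) := by
        rw [Finset.sum_comm]
        refine Finset.sum_congr rfl fun j _ => ?_
        simp [ite_mul]
      have h3 : (q : ℝ) * η = ∑ _i : Fin q, η := by simp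
      rw [h2, h3, ← Finset.sum_add_distrib]
      exact Finset.sum_le_sum fun i _ => by linarith [hf γ i]
    calc _ ≤ ∑ γ, Real.exp (q * η) * Real.exp (∑ j, e γ j * (f γ (g j)).1 (w j)) := by
          refine Finset.sum_le_sum fun γ _ => ?_
          rw [← Real.exp_add]
          exact Real.exp_le_exp.2 (h1 γ)
      _ = Real.exp (q * η) * ∑ γ, Real.exp (∑ j, e γ j * (f γ (g j)).1 (w j)) := by
          rw [Finset.mul_sum]
      _ ≤ _ := by
          gcongr
          exact main (fun γ i => (f γ i).1) fun γ i => (f γ i).2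
  have hlim : Filter.Tendsto
      (fun η : ℝ => Real.exp (q * η) * ((1 + s) ^ Fintype.card J / s ^ (d * q) * K))
      (nhdsWithin 0 (Set.Ioi 0)) (nhds ((1 + s) ^ Fintype.card J / s ^ (d * q) * K)) := by
    have hc : Continuous
        (fun η : ℝ => Real.exp (q * η) * ((1 + s) ^ Fintype.card J / s ^ (d * q) * K)) := by
      fun_prop
    have := (hc.tendsto 0).mono_left (nhdsWithin_le_nhds (s := Set.Ioi (0 : ℝ)))
    simpa using this
  exact ge_of_tendsto hlim (eventually_nhdsWithin_of_forall fun η hη => approx η hη)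

/-! ### Random selection of the sample among sample and ghosts -/

/-- The weights of a sample point `none` and of its `c` ghost copies `some a` in the difference
between the mean over the ghosts and the value at the sample point. -/
def ghostWeight (c : ℕ) : Option (Fin c) → ℝ
  | none => -1
  | some _ => (c : ℝ)⁻¹

/-- The exponential average of the form with coefficients `e`, over a finite family of
permutations of the indices, is at most `K` on every index set. The family is not required to be a
group. -/
def SelectionBound {J : Type} [Fintype J] (e : J → ℝ) (K : ℝ) : Prop :=
  ∃ (Γ : Type) (_ : Fintype Γ) (_ : Nonempty Γ) (σ : Γ → Equiv.Perm J),
    ∀ A : Finset J, ∑ γ, Real.exp (∑ j ∈ A, e (σ γ j)) ≤ Fintype.card Γ * K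

lemma sum_ghostWeight {c : ℕ} (hc : 1 ≤ c) : ∑ o, ghostWeight c o = 0 := by
  have : (c : ℝ) ≠ 0 := by positivity
  rw [Fintype.sum_option]
  simp [ghostWeight, this]

/-- As the coefficients sum to zero, a change of sign amounts to passing to complements. -/
lemma SelectionBound.neg {J : Type} [Fintype J] {e : J → ℝ} {K : ℝ} (h : SelectionBound e K)
    (h0 : ∑ j, e j = 0) : SelectionBound (fun j => -e j) K := by
  classical
  obtain ⟨Γ, i1, i2, σ, hσ⟩ := h
  refine ⟨Γ, i1, i2, σ, fun A => (Finset.sum_congr rfl fun γ _ => ?_).trans_le (hσ Aᶜ)⟩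
  have h1 : ∑ j, e (σ γ j) = 0 := by rw [Equiv.sum_comp (σ γ) e, h0]
  have h2 := Finset.sum_add_sum_compl A fun j => e (σ γ j)
  rw [Finset.sum_neg_distrib]
  congr 1
  linarith

/-- **Hoeffding's lemma** for the uniform distribution on a finite type. -/
lemma sum_exp_le_of_mem_Icc {α : Type} [Fintype α] [Nonempty α] (X : α → ℝ) {a b : ℝ}
    (hX : ∀ i, X i ∈ Set.Icc a b) (h0 : ∑ i, X i = 0) :
    ∑ i, Real.exp (X i) ≤ Fintype.card α * Real.exp ((b - a) ^ 2 / 8) := by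
  let _ : MeasurableSpace α := ⊤
  set μ : Measure α := (PMF.uniformOfFintype α).toMeasure with hμ
  have hcard : (0 : ℝ) < Fintype.card α := by exact_mod_cast Fintype.card_pos
  have hint : ∀ Y : α → ℝ, ∫ i, Y i ∂μ = (Fintype.card α : ℝ)⁻¹ * ∑ i, Y i := by
    intro Y
    rw [hμ, PMF.integral_eq_sum, Finset.mul_sum]
    simp
  have hm : AEMeasurable X μ := (measurable_of_finite X).aemeasurable
  have h := ProbabilityTheory.hasSubgaussianMGF_of_mem_Icc_of_integral_eq_zero hm
    (Filter.Eventually.of_forall hX) (by rw [hint, h0, mul_zero])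
  have h1 := h.mgf_le 1
  rw [ProbabilityTheory.mgf, hint] at h1
  have hab : 0 ≤ b - a := by
    obtain ⟨i⟩ := ‹Nonempty α›
    have := hX i
    linarith [this.1, this.2]
  have h2 : ((‖b - a‖₊ / 2) ^ 2 : NNReal) * (1 : ℝ) ^ 2 / 2 = (b - a) ^ 2 / 8 := by
    push_cast
    rw [Real.norm_eq_abs, abs_of_nonneg hab]; ring
  rw [h2] at h1
  simp only [one_mul] at h1
  rwa [inv_mul_le_iff₀ hcard] at h1

/-- In each row `{i} × Option (Fin c)` a uniformly chosen point takes the place of the sample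
point; Hoeffding's lemma applies to each row. -/
lemma selectionBound_rows {c : ℕ} (hc : 1 ≤ c) (n : ℕ) {t : ℝ} (ht : 0 ≤ t) :
    SelectionBound (fun j : Fin n × Option (Fin c) => t * ghostWeight c j.2)
      (Real.exp (n * ((t * ((c + 1) / c)) ^ 2 / 8))) := by
  classical
  have hc0 : (0 : ℝ) < c := by exact_mod_cast hc
  refine ⟨Fin n → Option (Fin c), inferInstance, inferInstance,
    fun γ => Equiv.prodCongrRight fun i => Equiv.swap none (γ i), fun A => ?_⟩
  have row : ∀ B : Finset (Option (Fin c)),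
      ∑ a, Real.exp (∑ o ∈ B, t * ghostWeight c (Equiv.swap none a o)) ≤
        Fintype.card (Option (Fin c)) * Real.exp ((t * ((c + 1) / c)) ^ 2 / 8) := by
    intro B
    have hval : ∀ a o, ghostWeight c (Equiv.swap none a o) =
        (c : ℝ)⁻¹ - if o = a then ((c : ℝ) + 1) / c else 0 := by
      intro a o
      by_cases h : o = a
      · subst h
        rw [Equiv.swap_apply_right]
        simp only [ghostWeight, if_true]
        field_simp; ring
      · rw [if_neg h, sub_zero]
        have : Equiv.swap none a o ≠ none := by
          intro h'
          rw [Equiv.swap_apply_eq_iff, Equiv.swap_apply_left] at h'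
          exact h h'
        obtain ⟨b, hb⟩ := Option.ne_none_iff_exists'.1 this
        rw [hb]; rfl
    have hsum : ∀ a, ∑ o ∈ B, t * ghostWeight c (Equiv.swap none a o) =
        t * (B.card * (c : ℝ)⁻¹) - if a ∈ B then t * (((c : ℝ) + 1) / c) else 0 := by
      intro a
      simp only [hval, ← Finset.mul_sum, Finset.sum_sub_distrib, Finset.sum_const, nsmul_eq_mul,
        Finset.sum_ite_eq']
      rw [mul_sub]
      split_ifs <;> simp
    have hT : 0 ≤ t * (((c : ℝ) + 1) / c) := by positivity
    have h := sum_exp_le_of_mem_Icc (a := t * (B.card * (c : ℝ)⁻¹) - t * (((c : ℝ) + 1) / c))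
      (b := t * (B.card * (c : ℝ)⁻¹))
      (fun a => ∑ o ∈ B, t * ghostWeight c (Equiv.swap none a o)) (fun a => by
        rw [hsum]; constructor <;> split_ifs <;> linarith) (by
        rw [Finset.sum_comm]
        refine Finset.sum_eq_zero fun o _ => ?_
        rw [← Finset.mul_sum]
        simp only [hval, Finset.sum_sub_distrib, Finset.sum_ite_eq, Finset.mem_univ, if_true]
        simp
        right
        field_simp; ring)
    convert h using 3
    ring
  calc ∑ γ : Fin n → Option (Fin c), Real.exp (∑ j ∈ A, t * ghostWeight c
          ((Equiv.prodCongrRight fun i => Equiv.swap none (γ i)) j).2)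
      = ∑ γ : Fin n → Option (Fin c), ∏ i, Real.exp (∑ o ∈ Finset.univ.filter (fun o => (i, o) ∈ A),
          t * ghostWeight c (Equiv.swap none (γ i) o)) := by
        refine Finset.sum_congr rfl fun γ _ => ?_
        rw [← Real.exp_sum]
        congr 1
        simp only [Finset.sum_filter]
        rw [← Fintype.sum_prod_type' (fun i o =>
          if (i, o) ∈ A then t * ghostWeight c (Equiv.swap none (γ i) o) else 0)]
        rw [← Finset.sum_filter]
        simp
    _ = ∏ i : Fin n, ∑ a, Real.exp (∑ o ∈ Finset.univ.filter (fun o => (i, o) ∈ A),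
          t * ghostWeight c (Equiv.swap none a o)) := by
        rw [Finset.prod_univ_sum]; simp
    _ ≤ ∏ _i : Fin n,
          (Fintype.card (Option (Fin c)) * Real.exp ((t * ((c + 1) / c)) ^ 2 / 8)) :=
        Finset.prod_le_prod (fun i _ => Finset.sum_nonneg fun _ _ => (Real.exp_pos _).le)
          fun i _ => row _
    _ = _ := by
        rw [Finset.prod_const, mul_pow, ← Real.exp_nat_mul]
        simp

/-- A uniformly chosen set of `n` points takes the place of the sample. Choosing each point
independently with odds `z` instead, a point contributes at most `1 + z`, whether or not it belongs
to the index set; the exact size `n` is then imposed by extracting the coefficient of `z ^ n`. -/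
lemma selectionBound_subsets {c : ℕ} (hc : 1 ≤ c) (n : ℕ) {t z : ℝ} (hz : 0 < z)
    (htz : Real.exp (t / c) + z * Real.exp (-t) ≤ 1 + z) :
    SelectionBound (fun j : Fin n × Option (Fin c) => t * ghostWeight c j.2)
      ((1 + z) ^ ((c + 1) * n) / (z ^ n * ((c + 1) * n).choose n)) := by
  classical
  set J := Fin n × Option (Fin c) with hJ
  have hcardJ : Fintype.card J = (c + 1) * n := by simp [hJ, mul_comm]
  set Γ := {S : Finset J // S.card = n} with hΓ
  have hcardΓ : Fintype.card Γ = ((c + 1) * n).choose n := by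
    exact (Fintype.card_finset_len n).trans (by rw [hcardJ])
  have hpos : 0 < ((c + 1) * n).choose n := Nat.choose_pos (Nat.le_mul_of_pos_left _ (by omega))
  have hne : Nonempty Γ := Fintype.card_pos_iff.1 (by omega)
  -- a permutation which moves `S` to the sample
  have hperm : ∀ S : Γ, ∃ σ : Equiv.Perm J, ∀ j, (σ j).2 = none ↔ j ∈ S.1 := by
    intro S
    have hcard : Fintype.card {j : J // j ∈ S.1} = Fintype.card {j : J // j.2 = none} := by
      rw [Fintype.card_coe, S.2]
      rw [Fintype.card_subtype]
      have : (Finset.univ.filter fun j : J => j.2 = none) = Finset.univ.map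
          ⟨fun i : Fin n => ((i, none) : J), fun a b h => (Prod.mk.inj h).1⟩ := by
        ext ⟨i, o⟩
        simp only [Finset.mem_filter, Finset.mem_univ, true_and, Finset.mem_map]
        constructor
        · rintro rfl; exact ⟨i, rfl⟩
        · rintro ⟨a, h⟩; exact (Prod.mk.inj h).2.symm
      rw [this]; simp
    refine ⟨(Fintype.equivOfCardEq hcard).extendSubtype, fun j => ⟨fun h => ?_, fun h => ?_⟩⟩
    · by_contra hj
      exact (Fintype.equivOfCardEq hcard).extendSubtype_not_mem j hj h
    · exact (Fintype.equivOfCardEq hcard).extendSubtype_mem j h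
  choose σ hσ using hperm
  refine ⟨Γ, inferInstance, hne, σ, fun A => ?_⟩
  have hterm : ∀ (S : Γ) (j : J), ghostWeight c (σ S j).2 = if j ∈ S.1 then -1 else (c : ℝ)⁻¹ := by
    intro S j
    by_cases h : j ∈ S.1
    · rw [if_pos h, (hσ S j).2 h]; rfl
    · rw [if_neg h]
      obtain ⟨b, hb⟩ := Option.ne_none_iff_exists'.1 (fun h' => h ((hσ S j).1 h'))
      rw [hb]; rfl
  set a : J → ℝ := fun j => if j ∈ A then Real.exp (t / c) else 1 with ha
  set b : J → ℝ := fun j => if j ∈ A then Real.exp (-t) else 1 with hb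
  have ha0 : ∀ j, 0 < a j := fun j => by simp only [ha]; split_ifs <;> positivity
  have hb0 : ∀ j, 0 < b j := fun j => by simp only [hb]; split_ifs <;> positivity
  have hexp : ∀ S : Γ, Real.exp (∑ j ∈ A, t * ghostWeight c (σ S j).2) =
      (∏ j ∈ S.1, b j) * ∏ j ∈ Finset.univ \ S.1, a j := by
    intro S
    have h1 : ∑ j ∈ A, t * ghostWeight c (σ S j).2 =
        ∑ j, if j ∈ A then (if j ∈ S.1 then -t else t / c) else 0 := by
      rw [← Finset.sum_filter, Finset.filter_univ_mem]
      refine Finset.sum_congr rfl fun j _ => ?_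
      rw [hterm]; split_ifs
      · ring
      · rw [div_eq_mul_inv]
    rw [h1, Real.exp_sum, ← Finset.prod_sdiff (Finset.subset_univ S.1), mul_comm]
    congr 1
    · refine Finset.prod_congr rfl fun j hj => ?_
      simp only [hb, hj, if_true]; split_ifs <;> simp
    · refine Finset.prod_congr rfl fun j hj => ?_
      simp only [ha, (Finset.mem_sdiff.1 hj).2, if_false]; split_ifs <;> simp
  have hmain : z ^ n * ∑ S : Γ, Real.exp (∑ j ∈ A, t * ghostWeight c (σ S j).2) ≤
      (1 + z) ^ ((c + 1) * n) := by
    calc z ^ n * ∑ S : Γ, Real.exp (∑ j ∈ A, t * ghostWeight c (σ S j).2)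
        = ∑ S : Γ, (∏ j ∈ S.1, z * b j) * ∏ j ∈ Finset.univ \ S.1, a j := by
          rw [Finset.mul_sum]
          refine Finset.sum_congr rfl fun S _ => ?_
          rw [hexp, Finset.prod_mul_distrib, Finset.prod_const, S.2, mul_assoc]
      _ ≤ ∑ S : Finset J, (∏ j ∈ S, z * b j) * ∏ j ∈ Finset.univ \ S, a j := by
          rw [← Finset.sum_subtype (Finset.univ.filter fun S : Finset J => S.card = n)
            (fun S => by simp) fun S => (∏ j ∈ S, z * b j) * ∏ j ∈ Finset.univ \ S, a j]
          refine Finset.sum_le_sum_of_subset_of_nonneg (Finset.filter_subset _ _) fun S _ _ => ?_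
          exact mul_nonneg (Finset.prod_nonneg fun j _ => (mul_pos hz (hb0 j)).le)
            (Finset.prod_nonneg fun j _ => (ha0 j).le)
      _ = ∏ j, (z * b j + a j) := by
          rw [Finset.prod_add]; simp
      _ ≤ ∏ _j : J, (1 + z) := by
          refine Finset.prod_le_prod (fun j _ => (add_pos (mul_pos hz (hb0 j)) (ha0 j)).le)
            fun j _ => ?_
          simp only [ha, hb]; split_ifs <;> linarith
      _ = _ := by rw [Finset.prod_const, Finset.card_univ, hcardJ]
  rw [hcardΓ]
  have hC : (0 : ℝ) < ((c + 1) * n).choose n := by exact_mod_cast hpos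
  have : (((c + 1) * n).choose n : ℝ) *
      ((1 + z) ^ ((c + 1) * n) / (z ^ n * ((c + 1) * n).choose n)) =
      (1 + z) ^ ((c + 1) * n) / z ^ n := by
    field_simp
  rw [this, le_div_iff₀ (by positivity), mul_comm]
  exact hmain

/-- Independent selections for each client. -/
lemma exists_selection_sigma {p : ℕ} {J : Fin p → Type} [∀ k, Fintype (J k)] {e : ∀ k, J k → ℝ}
    {K : Fin p → ℝ} (h : ∀ k, SelectionBound (e k) (K k)) :
    ∃ (Γ : Type) (_ : Fintype Γ) (_ : Nonempty Γ) (σ : Γ → ∀ k, Equiv.Perm (J k)),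
      ∀ A : Finset (Σ k, J k), ∑ γ, Real.exp (∑ j ∈ A, e j.1 (σ γ j.1 j.2)) ≤
        Fintype.card Γ * ∏ k, K k := by
  classical
  choose Γ i1 i2 σ hσ using h
  refine ⟨∀ k, Γ k, inferInstance, inferInstance, fun γ k => σ k (γ k), fun A => ?_⟩
  calc ∑ γ : ∀ k, Γ k, Real.exp (∑ j ∈ A, e j.1 (σ j.1 (γ j.1) j.2))
      = ∑ γ : ∀ k, Γ k, ∏ k, Real.exp (∑ j ∈ Finset.univ.filter
          (fun j : J k => (⟨k, j⟩ : Σ k, J k) ∈ A), e k (σ k (γ k) j)) := by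
        refine Finset.sum_congr rfl fun γ _ => ?_
        rw [← Real.exp_sum]
        congr 1
        simp only [Finset.sum_filter]
        rw [← Fintype.sum_sigma' (fun k j =>
          if (⟨k, j⟩ : Σ k, J k) ∈ A then e k (σ k (γ k) j) else 0)]
        rw [← Finset.sum_filter]
        simp
    _ = ∏ k, ∑ γ, Real.exp (∑ j ∈ Finset.univ.filter
          (fun j : J k => (⟨k, j⟩ : Σ k, J k) ∈ A), e k (σ k γ j)) := by
        rw [Finset.prod_univ_sum]; simp
    _ ≤ ∏ k, (Fintype.card (Γ k) * K k) :=
        Finset.prod_le_prod (fun i _ => Finset.sum_nonneg fun _ _ => (Real.exp_pos _).le)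
          fun k _ => hσ k _
    _ = _ := by
        rw [Finset.prod_mul_distrib]
        simp [Fintype.card_pi]

/-! ### Ghost samples -/

lemma measurePreserving_comp_equiv {Z I J : Type*} [MeasurableSpace Z] [Fintype I] [Fintype J]
    (μ : J → Measure Z) [∀ j, SigmaFinite (μ j)] (e : I ≃ J) :
    MeasurePreserving (fun (w : J → Z) (i : I) => w (e i)) (Measure.pi μ)
      (Measure.pi fun i => μ (e i)) := by
  refine ⟨by fun_prop, (Measure.pi_eq fun s hs => ?_).symm⟩
  rw [Measure.map_apply (by fun_prop) (MeasurableSet.univ_pi hs)]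
  have : (fun (w : J → Z) (i : I) => w (e i)) ⁻¹' (Set.univ.pi s) =
      Set.univ.pi fun j => s (e.symm j) := by
    ext w
    simp only [Set.mem_preimage, Set.mem_univ_pi]
    exact ⟨fun h j => by simpa using h (e.symm j), fun h i => by simpa using h (e i)⟩
  rw [this, Measure.pi_pi]
  exact (Fintype.prod_equiv e _ _ fun i => by simp).symm

/-- Measurability of the class passes from samples indexed by `Fin n` to samples with an arbitrary
finite index type. -/
lemma IsMeasurableClass.aemeasurable {Z ι J : Type*} [MeasurableSpace Z] [Fintype J]
    {F : Set (Z → ℝ)} {D : ι → Measure Z} [∀ k, IsProbabilityMeasure (D k)]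
    (h : IsMeasurableClass F D) (κ : J → ι) (e : J → ℝ) :
    AEMeasurable (fun w : J → Z => ⨆ f : F, ∑ j, e j * f.1 (w j))
      (Measure.pi fun j => D (κ j)) := by
  set E := (Fintype.equivFin J).symm with hE
  have h1 := h (Fintype.card J) (fun i => κ (E i)) (fun i => e (E i))
  have h2 := measurePreserving_comp_equiv (fun j => D (κ j)) E
  have h3 := h1.comp_quasiMeasurePreserving h2.quasiMeasurePreserving
  refine h3.congr (Filter.Eventually.of_forall fun w => ?_)
  simp only [Function.comp]
  exact iSup_congr fun f => Equiv.sum_comp E fun j => e j * f.1 (w j)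

/-- Indices of the points of all clients: for client `k`, the `m k` sample points `(i, none)` and
for each of them the `c` ghost copies `(i, some a)`. -/
abbrev GhostIndex {p : ℕ} (m : Fin p → ℕ) (c : ℕ) : Type :=
  Σ k, Fin (m k) × Option (Fin c)

/-- The points of a sample `S` and of `c` further samples `T a` as one family. -/
def withGhosts {Z : Type*} {p c : ℕ} {m : Fin p → ℕ} (S : (k : Fin p) → Fin (m k) → Z)
    (T : Fin c → (k : Fin p) → Fin (m k) → Z) : GhostIndex m c → Z
  | ⟨k, i, none⟩ => S k i
  | ⟨k, i, some a⟩ => T a k i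

instance {Z : Type*} [MeasurableSpace Z] {p : ℕ} (m : Fin p → ℕ) (D : Fin p → Measure Z)
    [∀ k, IsProbabilityMeasure (D k)] : IsProbabilityMeasure (sampleLaw m D) := by
  unfold sampleLaw; infer_instance

lemma measurePreserving_withGhosts {Z : Type*} [MeasurableSpace Z] {p : ℕ} (c : ℕ)
    (m : Fin p → ℕ) (D : Fin p → Measure Z) [∀ k, IsProbabilityMeasure (D k)] :
    MeasurePreserving (fun x : _ × _ => withGhosts x.1 x.2)
      ((sampleLaw m D).prod (Measure.pi fun _ : Fin c => sampleLaw m D))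
      (Measure.pi fun j : GhostIndex m c => D j.1) := by
  have hm : Measurable (fun x : ((k : Fin p) → Fin (m k) → Z) ×
      (Fin c → (k : Fin p) → Fin (m k) → Z) => withGhosts x.1 x.2) := by
    refine measurable_pi_lambda _ ?_
    rintro ⟨k, i, _ | a⟩
    · simp only [withGhosts]; fun_prop
    · simp only [withGhosts]; fun_prop
  refine ⟨hm, (Measure.pi_eq fun s hs => ?_).symm⟩
  rw [Measure.map_apply hm (MeasurableSet.univ_pi hs)]
  have : (fun x : ((k : Fin p) → Fin (m k) → Z) ×
      (Fin c → (k : Fin p) → Fin (m k) → Z) => withGhosts x.1 x.2) ⁻¹' (Set.univ.pi s) =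
      (Set.univ.pi fun k => Set.univ.pi fun i => s ⟨k, i, none⟩) ×ˢ
      (Set.univ.pi fun a => Set.univ.pi fun k => Set.univ.pi fun i => s ⟨k, i, some a⟩) := by
    ext ⟨S, T⟩
    simp only [Set.mem_preimage, Set.mem_univ_pi, Set.mem_prod]
    constructor
    · intro h
      exact ⟨fun k i => h ⟨k, i, none⟩, fun a k i => h ⟨k, i, some a⟩⟩
    · rintro ⟨h1, h2⟩ ⟨k, i, _ | a⟩
      · exact h1 k i
      · exact h2 a k i
  rw [this, Measure.prod_prod]
  simp only [sampleLaw, Measure.pi_pi]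
  rw [Finset.prod_comm (s := (Finset.univ : Finset (Fin c))), ← Finset.prod_mul_distrib,
    Fintype.prod_sigma]
  refine Finset.prod_congr rfl fun k _ => ?_
  rw [Finset.prod_comm (s := (Finset.univ : Finset (Fin c))), ← Finset.prod_mul_distrib,
    Fintype.prod_prod_type]
  exact Finset.prod_congr rfl fun i _ => by rw [Fintype.prod_option]

/-- The exponential moment of the supremum over `q` functions, one for each cluster, of the weighted
differences between ghosts and sample: averaging over selections, which leaves the law of the
points unchanged, reduces it to the bound for fixed points. -/
lemma lintegral_exp_iSup_le {Z : Type*} [MeasurableSpace Z] {p q c d : ℕ} {m : Fin p → ℕ}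
    {D : Fin p → Measure Z} [∀ k, IsProbabilityMeasure (D k)] {F : Set (Z → ℝ)}
    (hF : ∀ f ∈ F, ∀ z, f z ∈ Set.Icc (0 : ℝ) 1) (hne : F.Nonempty)
    (hd : ∀ B : Finset Z, PseudoShatters F B → B.card ≤ d) (φ : Fin p → Fin q)
    {t : ℝ} {K : Fin p → ℝ}
    (hK : ∀ k, SelectionBound (fun j : Fin (m k) × Option (Fin c) => t * ghostWeight c j.2) (K k))
    {s : ℝ} (hs0 : 0 < s) (hs1 : s ≤ 1)
    (hmeas : AEMeasurable (fun w : GhostIndex m c → Z => ENNReal.ofReal (Real.exp (∑ i, ⨆ f : F,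
      ∑ j, (if φ j.1 = i then t * ghostWeight c j.2.2 else 0) * f.1 (w j))))
      (Measure.pi fun j : GhostIndex m c => D j.1)) :
    ∫⁻ w : GhostIndex m c → Z, ENNReal.ofReal (Real.exp (∑ i, ⨆ f : F,
      ∑ j, (if φ j.1 = i then t * ghostWeight c j.2.2 else 0) * f.1 (w j)))
      ∂(Measure.pi fun j : GhostIndex m c => D j.1) ≤
      ENNReal.ofReal ((1 + s) ^ ((c + 1) * ∑ k, m k) / s ^ (d * q) * ∏ k, K k) := by
  obtain ⟨Γ, i1, i2, σ, hσ⟩ := exists_selection_sigma hK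
  set μ := Measure.pi fun j : GhostIndex m c => D j.1 with hμ
  set H : (GhostIndex m c → Z) → ENNReal := fun w => ENNReal.ofReal (Real.exp (∑ i, ⨆ f : F,
      ∑ j, (if φ j.1 = i then t * ghostWeight c j.2.2 else 0) * f.1 (w j))) with hH
  have hcardJ : Fintype.card (GhostIndex m c) = (c + 1) * ∑ k, m k := by
    simp only [GhostIndex, Fintype.card_sigma, Fintype.card_prod, Fintype.card_fin,
      Fintype.card_option]
    rw [← Finset.sum_mul, mul_comm]
  have hpres : ∀ γ, MeasurePreserving (fun (w : GhostIndex m c → Z) (j : GhostIndex m c) =>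
      w (Equiv.sigmaCongrRight (fun k => (σ γ k).symm) j)) μ μ := fun γ =>
    measurePreserving_comp_equiv (fun j : GhostIndex m c => D j.1)
      (Equiv.sigmaCongrRight (fun k => (σ γ k).symm))
  have hperm : ∀ γ, ∫⁻ w, H (fun j => w (Equiv.sigmaCongrRight (fun k => (σ γ k).symm) j)) ∂μ =
      ∫⁻ w, H w ∂μ := by
    intro γ
    have h := hpres γ
    rw [← lintegral_map' (μ := μ) (f := H) (by rw [h.map_eq]; exact hmeas)
      h.measurable.aemeasurable, h.map_eq]
  have hval : ∀ γ (w : GhostIndex m c → Z), H (fun j => w (Equiv.sigmaCongrRight (fun k => (σ γ k).symm) j)) =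
      ENNReal.ofReal (Real.exp (∑ i, ⨆ f : F, ∑ j : GhostIndex m c,
        (if φ j.1 = i then t * ghostWeight c (σ γ j.1 j.2).2 else 0) * f.1 (w j))) := by
    intro γ w
    simp only [hH]
    congr 2
    refine Finset.sum_congr rfl fun i _ => iSup_congr fun f => ?_
    rw [← Equiv.sum_comp (Equiv.sigmaCongrRight (fun k => (σ γ k)))]
    refine Finset.sum_congr rfl fun j _ => ?_
    simp only [Equiv.sigmaCongrRight, Equiv.coe_fn_mk, Equiv.symm_apply_apply]
    rfl
  have hΓ : (0 : ℝ) < Fintype.card Γ := by exact_mod_cast Fintype.card_pos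
  have hbound : ∀ w : GhostIndex m c → Z, ∑ γ, H (fun j => w (Equiv.sigmaCongrRight (fun k => (σ γ k).symm) j)) ≤
      ENNReal.ofReal (Fintype.card Γ *
        ((1 + s) ^ ((c + 1) * ∑ k, m k) / s ^ (d * q) * ∏ k, K k)) := by
    intro w
    simp only [hval]
    rw [← ENNReal.ofReal_sum_of_nonneg fun _ _ => (Real.exp_pos _).le]
    refine ENNReal.ofReal_le_ofReal ?_
    have := sum_exp_iSup_le hF hne hd (fun j : GhostIndex m c => φ j.1) w
      (fun γ j => t * ghostWeight c (σ γ j.1 j.2).2) hσ hs0 hs1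
    rw [hcardJ] at this
    refine this.trans_eq ?_
    ring
  have hsum : (Fintype.card Γ : ENNReal) * ∫⁻ w, H w ∂μ ≤ ENNReal.ofReal (Fintype.card Γ *
        ((1 + s) ^ ((c + 1) * ∑ k, m k) / s ^ (d * q) * ∏ k, K k)) := by
    calc (Fintype.card Γ : ENNReal) * ∫⁻ w, H w ∂μ
        = ∑ γ, ∫⁻ w, H (fun j => w (Equiv.sigmaCongrRight (fun k => (σ γ k).symm) j)) ∂μ := by
          rw [Finset.sum_congr rfl fun γ _ => hperm γ]; simp
      _ = ∫⁻ w, ∑ γ, H (fun j => w (Equiv.sigmaCongrRight (fun k => (σ γ k).symm) j)) ∂μ :=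
          (lintegral_finsetSum' _ fun γ _ =>
            hmeas.comp_quasiMeasurePreserving (hpres γ).quasiMeasurePreserving).symm
      _ ≤ ∫⁻ _w, ENNReal.ofReal (Fintype.card Γ *
        ((1 + s) ^ ((c + 1) * ∑ k, m k) / s ^ (d * q) * ∏ k, K k)) ∂μ := lintegral_mono hbound
      _ = _ := by simp
  rw [ENNReal.ofReal_mul hΓ.le, ENNReal.ofReal_natCast] at hsum
  exact (ENNReal.mul_le_mul_iff_right (by exact_mod_cast Fintype.card_ne_zero)
    (ENNReal.natCast_ne_top _)).1 hsum

lemma integral_eval_sampleLaw {Z : Type*} [MeasurableSpace Z] {p c : ℕ}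
    {m : Fin p → ℕ} {D : Fin p → Measure Z} [∀ k, IsProbabilityMeasure (D k)] {f : Z → ℝ}
    (hf : Measurable f) (a : Fin c) (k : Fin p) (i : Fin (m k)) :
    ∫ T : Fin c → (k : Fin p) → Fin (m k) → Z, f (T a k i)
      ∂(Measure.pi fun _ : Fin c => sampleLaw m D) = ∫ z, f z ∂(D k) := by
  have h1 := measurePreserving_eval (fun _ : Fin c => sampleLaw m D) a
  have h2 := measurePreserving_eval (fun k => Measure.pi fun _ : Fin (m k) => D k) k
  have h3 := measurePreserving_eval (fun _ : Fin (m k) => D k) i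
  have h := (h3.comp h2).comp h1
  rw [← h.map_eq, integral_map h.measurable.aemeasurable hf.aestronglyMeasurable]
  rfl

/-- The tail bound, for a fixed assignment `φ` of clusters to clients: outside a measurable set of
small probability, the deviations between expected and empirical sums are bounded for all
choices of functions. -/
theorem exists_measurableSet_deviation_le {Z : Type*} [MeasurableSpace Z] {p q c d : ℕ}
    (hc : 1 ≤ c) {m : Fin p → ℕ}
    {D : Fin p → Measure Z} [∀ k, IsProbabilityMeasure (D k)] {F : Set (Z → ℝ)}
    (hF : ∀ f ∈ F, ∀ z, f z ∈ Set.Icc (0 : ℝ) 1) (hne : F.Nonempty)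
    (hFm : ∀ f ∈ F, Measurable f) (hclass : IsMeasurableClass F D)
    (hd : ∀ B : Finset Z, PseudoShatters F B → B.card ≤ d) (φ : Fin p → Fin q)
    {t : ℝ} {K : Fin p → ℝ}
    (hK : ∀ k, SelectionBound (fun j : Fin (m k) × Option (Fin c) => t * ghostWeight c j.2) (K k))
    {s : ℝ} (hs0 : 0 < s) (hs1 : s ≤ 1) (ε : ℝ) :
    ∃ E : Set ((k : Fin p) → Fin (m k) → Z), MeasurableSet E ∧
      sampleLaw m D E ≤ ENNReal.ofReal
        ((1 + s) ^ ((c + 1) * ∑ k, m k) / s ^ (d * q) * (∏ k, K k) * Real.exp (-ε)) ∧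
      ∀ S ∉ E, ∀ f : Fin q → Z → ℝ, (∀ i, f i ∈ F) →
        t * ∑ k, ∑ i, ((∫ z, f (φ k) z ∂(D k)) - f (φ k) (S k i)) ≤ ε := by
  set P := sampleLaw m D with hP
  set Q := Measure.pi fun _ : Fin c => sampleLaw m D with hQ
  set μ := Measure.pi fun j : GhostIndex m c => D j.1 with hμ
  set G : (GhostIndex m c → Z) → ℝ := fun w => ∑ i, ⨆ f : F,
      ∑ j, (if φ j.1 = i then t * ghostWeight c j.2.2 else 0) * f.1 (w j) with hG
  have hGm : AEMeasurable G μ := by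
    refine Finset.aemeasurable_fun_sum _ fun i _ => ?_
    exact hclass.aemeasurable (fun j : GhostIndex m c => j.1)
      fun j => if φ j.1 = i then t * ghostWeight c j.2.2 else 0
  have hHm : AEMeasurable (fun w => ENNReal.ofReal (Real.exp (G w))) μ :=
    (Real.measurable_exp.comp_aemeasurable hGm).ennreal_ofReal
  have hpres := measurePreserving_withGhosts c m D
  have hHm' : AEMeasurable (fun x : ((k : Fin p) → Fin (m k) → Z) ×
      (Fin c → (k : Fin p) → Fin (m k) → Z) => ENNReal.ofReal (Real.exp (G (withGhosts x.1 x.2))))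
      (P.prod Q) := hHm.comp_quasiMeasurePreserving hpres.quasiMeasurePreserving
  set Hm := hHm'.mk _ with hHmk
  have hHmm : Measurable Hm := hHm'.measurable_mk
  have hae := Measure.ae_ae_of_ae_prod hHm'.ae_eq_mk
  set Ψ : ((k : Fin p) → Fin (m k) → Z) → ENNReal := fun S => ∫⁻ T, Hm (S, T) ∂Q with hΨ
  have hΨm : Measurable Ψ := hHmm.lintegral_prod_right'
  have hΨint : ∫⁻ S, Ψ S ∂P ≤ ENNReal.ofReal
      ((1 + s) ^ ((c + 1) * ∑ k, m k) / s ^ (d * q) * ∏ k, K k) := by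
    have h1 : ∫⁻ S, Ψ S ∂P = ∫⁻ w, ENNReal.ofReal (Real.exp (G w)) ∂μ := by
      rw [hΨ, ← lintegral_prod _ hHmm.aemeasurable, ← lintegral_congr_ae hHm'.ae_eq_mk,
        hμ, ← hpres.map_eq, lintegral_map' (by rw [hpres.map_eq]; exact hHm)
          hpres.measurable.aemeasurable]
    rw [h1]
    exact lintegral_exp_iSup_le hF hne hd φ hK hs0 hs1 hHm
  set N := {S | ¬ ∀ᵐ T ∂Q, ENNReal.ofReal (Real.exp (G (withGhosts S T))) = Hm (S, T)} with hN
  have hN0 : P (toMeasurable P N) = 0 := by rw [measure_toMeasurable]; exact ae_iff.1 hae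
  have hε0 : ENNReal.ofReal (Real.exp ε) ≠ 0 := by
    simpa using Real.exp_pos ε
  refine ⟨toMeasurable P N ∪ {S | ENNReal.ofReal (Real.exp ε) ≤ Ψ S},
    (measurableSet_toMeasurable _ _).union (measurableSet_le measurable_const hΨm), ?_, ?_⟩
  · refine (measure_union_le _ _).trans ?_
    rw [hN0, zero_add]
    refine (meas_ge_le_lintegral_div hΨm.aemeasurable hε0 ENNReal.ofReal_ne_top).trans ?_
    rw [Real.exp_neg, ← div_eq_mul_inv, ENNReal.ofReal_div_of_pos (Real.exp_pos ε)]
    gcongr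
  · intro S hS f hf
    have hSN : ∀ᵐ T ∂Q, ENNReal.ofReal (Real.exp (G (withGhosts S T))) = Hm (S, T) := by
      by_contra h
      exact hS (Or.inl (subset_toMeasurable P N h))
    have hSΨ : Ψ S < ENNReal.ofReal (Real.exp ε) := not_le.1 fun h => hS (Or.inr h)
    set Y : (Fin c → (k : Fin p) → Fin (m k) → Z) → ℝ := fun T =>
      ∑ j : GhostIndex m c, t * ghostWeight c j.2.2 * f (φ j.1) (withGhosts S T j) with hY
    have hwm : ∀ j : GhostIndex m c, Measurable fun T => withGhosts S T j := by
      rintro ⟨k, i, _ | a⟩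
      · simp only [withGhosts]; fun_prop
      · simp only [withGhosts]; fun_prop
    have hterm : ∀ j : GhostIndex m c,
        Measurable fun T => t * ghostWeight c j.2.2 * f (φ j.1) (withGhosts S T j) :=
      fun j => ((hFm _ (hf _)).comp (hwm j)).const_mul _
    have hbd : ∀ (j : GhostIndex m c) T,
        |t * ghostWeight c j.2.2 * f (φ j.1) (withGhosts S T j)| ≤ |t * ghostWeight c j.2.2| := by
      intro j T
      rw [abs_mul]
      have h1 := hF _ (hf (φ j.1)) (withGhosts S T j)
      rw [abs_of_nonneg h1.1]
      exact mul_le_of_le_one_right (abs_nonneg _) h1.2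
    have hint : ∀ j : GhostIndex m c,
        Integrable (fun T => t * ghostWeight c j.2.2 * f (φ j.1) (withGhosts S T j)) Q := fun j =>
      Integrable.of_bound (hterm j).aestronglyMeasurable _
        (Filter.Eventually.of_forall fun T => by rw [Real.norm_eq_abs]; exact hbd j T)
    have hYint : Integrable Y Q := integrable_finsetSum _ fun j _ => hint j
    have hYexp : Integrable (fun T => Real.exp (Y T)) Q := by
      refine Integrable.of_bound
        (C := Real.exp (∑ j : GhostIndex m c, |t * ghostWeight c j.2.2|)) ?_ ?_
      · exact (Real.measurable_exp.comp
          (Finset.measurable_sum _ fun j _ => hterm j)).aestronglyMeasurable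
      · refine Filter.Eventually.of_forall fun T => ?_
        rw [Real.norm_eq_abs, Real.abs_exp]
        exact Real.exp_le_exp.2 (Finset.sum_le_sum fun j _ => (le_abs_self _).trans (hbd j T))
    -- the mean over the ghosts is the deviation to be bounded
    have hmean : ∫ T, Y T ∂Q =
        t * ∑ k, ∑ i, ((∫ z, f (φ k) z ∂(D k)) - f (φ k) (S k i)) := by
      rw [hY, integral_finsetSum _ fun j _ => hint j, Fintype.sum_sigma, Finset.mul_sum]
      refine Finset.sum_congr rfl fun k _ => ?_
      rw [Fintype.sum_prod_type, Finset.mul_sum]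
      refine Finset.sum_congr rfl fun i _ => ?_
      rw [Fintype.sum_option]
      simp only [integral_const_mul, ghostWeight, withGhosts,
        integral_eval_sampleLaw (hFm _ (hf _)), hQ]
      have hc0 : (c : ℝ) ≠ 0 := by positivity
      simp
      field_simp
      ring
    have hYG : ∀ T, Y T ≤ G (withGhosts S T) := by
      intro T
      have h2 : Y T = ∑ i, ∑ j : GhostIndex m c,
          (if φ j.1 = i then t * ghostWeight c j.2.2 else 0) * f i (withGhosts S T j) := by
        rw [Finset.sum_comm]
        refine Finset.sum_congr rfl fun j _ => ?_
        simp [ite_mul]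
      rw [h2]
      refine Finset.sum_le_sum fun i _ => ?_
      refine le_ciSup (f := fun f : F => ∑ j : GhostIndex m c,
        (if φ j.1 = i then t * ghostWeight c j.2.2 else 0) * f.1 (withGhosts S T j))
        ⟨∑ j : GhostIndex m c, |if φ j.1 = i then t * ghostWeight c j.2.2 else 0|, ?_⟩
        (⟨f i, hf i⟩ : F)
      rintro _ ⟨f', rfl⟩
      refine Finset.sum_le_sum fun j _ => (le_abs_self _).trans ?_
      rw [abs_mul]
      have h1 := hF _ f'.2 (withGhosts S T j)
      rw [abs_of_nonneg h1.1]
      exact mul_le_of_le_one_right (abs_nonneg _) h1.2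
    have hlt : ENNReal.ofReal (Real.exp (∫ T, Y T ∂Q)) < ENNReal.ofReal (Real.exp ε) := by
      calc ENNReal.ofReal (Real.exp (∫ T, Y T ∂Q))
          ≤ ENNReal.ofReal (∫ T, Real.exp (Y T) ∂Q) := by
            refine ENNReal.ofReal_le_ofReal ?_
            exact convexOn_exp.map_integral_le Real.continuous_exp.continuousOn isClosed_univ
              (Filter.Eventually.of_forall fun _ => Set.mem_univ _) hYint hYexp
        _ = ∫⁻ T, ENNReal.ofReal (Real.exp (Y T)) ∂Q :=
            ofReal_integral_eq_lintegral_ofReal hYexp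
              (Filter.Eventually.of_forall fun T => (Real.exp_pos _).le)
        _ ≤ ∫⁻ T, Hm (S, T) ∂Q := by
            refine lintegral_mono_ae ?_
            filter_upwards [hSN] with T hT
            rw [← hT]
            exact ENNReal.ofReal_le_ofReal (Real.exp_le_exp.2 (hYG T))
        _ < _ := hSΨ
    rw [← hmean]
    exact (Real.exp_lt_exp.1 ((ENNReal.ofReal_lt_ofReal_iff (Real.exp_pos ε)).1 hlt)).le

/-! ### The numerical inequality between rates -/

/-- The binomial distribution with parameters `5 * n` and `1 / 5` takes its mean `n` with
probability at least `1 / (5 * n + 1)`. -/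
lemma pow_le_choose_five_mul (n : ℕ) :
    (3125 / 256 : ℝ) ^ n ≤ (5 * n + 1) * ((5 * n).choose n : ℝ) := by
  induction n with
  | zero => simp
  | succ n ih =>
    -- the ratio of consecutive binomial coefficients
    have hrec : ((5 * (n + 1)).choose (n + 1) : ℝ) *
        ((n + 1) * ((4 * n + 4) * (4 * n + 3) * (4 * n + 2) * (4 * n + 1))) =
        ((5 * n).choose n : ℝ) *
          ((5 * n + 5) * (5 * n + 4) * (5 * n + 3) * (5 * n + 2) * (5 * n + 1)) := by
      have h1 := Nat.choose_mul_factorial_mul_factorial (show n ≤ 5 * n by omega)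
      have h2 := Nat.choose_mul_factorial_mul_factorial
        (show n + 1 ≤ 5 * (n + 1) by omega)
      rw [show 5 * n - n = 4 * n by omega] at h1
      rw [show 5 * (n + 1) - (n + 1) = 4 * n + 3 + 1 by omega,
        show 5 * (n + 1) = 5 * n + 4 + 1 by omega] at h2
      simp only [Nat.factorial_succ] at h2
      rw [← h1] at h2
      have hpos : (n.factorial : ℝ) * ((4 * n).factorial : ℝ) ≠ 0 := by positivity
      have h3 := congrArg (Nat.cast : ℕ → ℝ) h2
      push_cast at h3
      refine mul_right_cancel₀ hpos ?_
      rw [show 5 * (n + 1) = 5 * n + 4 + 1 by omega]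
      linear_combination h3
    have hC : (0 : ℝ) < ((5 * n).choose n : ℝ) := by
      exact_mod_cast Nat.choose_pos (by omega)
    have hden : (0 : ℝ) < (n + 1) * ((4 * n + 4) * (4 * n + 3) * (4 * n + 2) * (4 * n + 1)) := by
      positivity
    have hn : (0 : ℝ) ≤ n := Nat.cast_nonneg n
    rw [pow_succ]
    push_cast
    have hpoly : (3125 / 256 : ℝ) * (5 * n + 1) *
        ((n + 1) * ((4 * n + 4) * (4 * n + 3) * (4 * n + 2) * (4 * n + 1))) ≤
        (5 * (n + 1) + 1) *
          ((5 * n + 5) * (5 * n + 4) * (5 * n + 3) * (5 * n + 2) * (5 * n + 1)) := by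
      have : (0 : ℝ) ≤ (5 * n + 1) * (n + 1) *
          (5 * ((5 * n + 6) * ((5 * n + 4) * (5 * n + 3) * (5 * n + 2))) -
            3125 / 256 * ((4 * n + 4) * (4 * n + 3) * (4 * n + 2) * (4 * n + 1))) := by
        refine mul_nonneg (by positivity) ?_
        ring_nf
        positivity
      linarith
    calc (3125 / 256 : ℝ) ^ n * (3125 / 256)
        ≤ (5 * n + 1) * ((5 * n).choose n : ℝ) * (3125 / 256) := by gcongr
      _ ≤ (5 * ((n : ℝ) + 1) + 1) * ((5 * (n + 1)).choose (n + 1) : ℝ) := by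
          rw [← mul_le_mul_iff_left₀ hden, mul_assoc (5 * ((n : ℝ) + 1) + 1), hrec]
          calc _ = ((5 * n).choose n : ℝ) * ((3125 / 256 : ℝ) * (5 * n + 1) *
                ((n + 1) * ((4 * n + 4) * (4 * n + 3) * (4 * n + 2) * (4 * n + 1)))) := by ring
            _ ≤ ((5 * n).choose n : ℝ) * ((5 * (n + 1) + 1) *
                ((5 * n + 5) * (5 * n + 4) * (5 * n + 3) * (5 * n + 2) * (5 * n + 1))) := by
                gcongr
            _ = _ := by ring

/-- As `x * (1 - log x)` is concave, so is its square root: a linear function that is below a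
multiple of the root at the ends of an interval is below it inside. -/
lemma linear_le_sqrt_of_endpoints {a b fa fb c₀ c₁ L x : ℝ} (ha : 0 < a) (hab : a < b)
    (hL : 0 ≤ L) (hfa2 : fa ^ 2 ≤ a * (1 - Real.log a))
    (hfb2 : fb ^ 2 ≤ b * (1 - Real.log b)) (h1 : c₀ + c₁ * a ≤ L * fa)
    (h2 : c₀ + c₁ * b ≤ L * fb) (hx1 : a ≤ x) (hx2 : x ≤ b) :
    c₀ + c₁ * x ≤ L * √(x * (1 - Real.log x)) := by
  set θ := (x - a) / (b - a) with hθ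
  have hba : 0 < b - a := by linarith
  have hθ0 : 0 ≤ θ := div_nonneg (by linarith) hba.le
  have hθ1 : θ ≤ 1 := (div_le_one hba).2 (by linarith)
  have hx : x = (1 - θ) * a + θ * b := by rw [hθ]; field_simp; ring
  have hconc := Real.concaveOn_negMulLog.2 (show a ∈ Set.Ici 0 from ha.le)
    (show b ∈ Set.Ici 0 from (ha.trans hab).le) (show 0 ≤ 1 - θ by linarith) hθ0 (by ring)
  simp only [smul_eq_mul, ← hx, Real.negMulLog] at hconc
  have hsqrt : (1 - θ) * fa + θ * fb ≤ √(x * (1 - Real.log x)) := by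
    refine Real.le_sqrt_of_sq_le ?_
    have hsq : ((1 - θ) * fa + θ * fb) ^ 2 ≤ (1 - θ) * fa ^ 2 + θ * fb ^ 2 := by
      nlinarith [mul_nonneg (mul_nonneg hθ0 (sub_nonneg.2 hθ1)) (sq_nonneg (fa - fb))]
    have e1 := mul_le_mul_of_nonneg_left hfa2 (sub_nonneg.2 hθ1)
    have e2 := mul_le_mul_of_nonneg_left hfb2 hθ0
    nlinarith
  calc c₀ + c₁ * x = (1 - θ) * (c₀ + c₁ * a) + θ * (c₀ + c₁ * b) := by rw [hx]; ring
    _ ≤ (1 - θ) * (L * fa) + θ * (L * fb) := by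
        have := sub_nonneg.2 hθ1
        gcongr
    _ = L * ((1 - θ) * fa + θ * fb) := by ring
    _ ≤ _ := by gcongr

/-- The tangent of the logarithm at `a` lies above its graph. -/
lemma log_le_log_add {a y : ℝ} (ha : 0 < a) (hy : 0 < y) :
    Real.log y ≤ Real.log a + (y / a - 1) := by
  have h := Real.log_le_sub_one_of_pos (div_pos hy ha)
  rw [Real.log_div hy.ne' ha.ne'] at h
  linarith

/-- The logarithm of the bound on the number of level sets (first two terms), plus that of the
generating function of selections (next two terms), minus that of the number of selections; all per
sample point, with `4` ghosts for each sample point, and `x` the ratio of the dimension to the sample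
size. -/
def logRate (z s x : ℝ) : ℝ :=
  -x * Real.log s + 5 * Real.log (1 + s) + 5 * Real.log (1 + z) - Real.log z -
    (5 * Real.log 5 - 4 * Real.log 4)

lemma log_four : Real.log 4 = 2 * Real.log 2 := by
  rw [show (4 : ℝ) = 2 ^ 2 by norm_num, Real.log_pow]; norm_num

lemma log_smooth (a b c : ℤ) : Real.log ((2 : ℝ) ^ a * 3 ^ b * 5 ^ c) =
    a * Real.log 2 + b * Real.log 3 + c * Real.log 5 := by
  rw [Real.log_mul (by positivity) (by positivity), Real.log_mul (by positivity) (by positivity),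
    Real.log_zpow, Real.log_zpow, Real.log_zpow]

lemma one_sub_sq_le_sqrt {u : ℝ} (hu0 : 0 < u) (hu : u ≤ 7 / 25) :
    1 - 7 / 20 * u ^ 2 ≤ √((1 - u) * (1 - Real.log (1 - u))) := by
  refine Real.le_sqrt_of_sq_le ?_
  have hlog : u + u ^ 2 / 2 ≤ -Real.log (1 - u) := by
    have h1u : 0 < 1 - u := by linarith
    have h1 := Real.le_log_one_add_of_nonneg (x := u / (1 - u)) (by positivity)
    rw [show 1 + u / (1 - u) = (1 - u)⁻¹ by field_simp; ring, Real.log_inv] at h1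
    refine le_trans ?_ h1
    rw [show 2 * (u / (1 - u)) / (u / (1 - u) + 2) = 2 * u / (2 - u) by
      have : 2 - u ≠ 0 := by linarith
      have : u + (1 - u) * 2 ≠ 0 := by linarith
      field_simp; ring]
    rw [le_div_iff₀ (by linarith)]
    nlinarith [pow_pos hu0 3]
  have h1 : (1 - u) * (1 + u + u ^ 2 / 2) ≤ (1 - u) * (1 - Real.log (1 - u)) :=
    mul_le_mul_of_nonneg_left (by linarith) (by linarith)
  refine le_trans ?_ h1
  have h3 : u ^ 2 * (1 / 5 - u / 2 - 49 / 400 * u ^ 2) ≥ 0 := by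
    refine mul_nonneg (sq_nonneg u) ?_
    nlinarith
  nlinarith

/-- As `x = 1 - u` tends to `1` the exponent has to grow: `w = 3 / u` does. -/
lemma exists_logRate_le_near_one {u : ℝ} (hu0 : 0 < u) (hu : u ≤ 7 / 25) :
    ∃ w z s : ℝ, 27 / 16 ≤ w ∧ 0 < z ∧ w ^ 4 * (w - 1) ≤ z * (w ^ 4 - 1) ∧ 0 < s ∧ s ≤ 1 ∧
      logRate z s (1 - u) ≤ 4 * Real.log w * √((1 - u) * (1 - Real.log (1 - u))) := by
  have l2 := Real.log_two_gt_d9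
  have l2' := Real.log_two_lt_d9
  have l5 := Real.log_five_gt_d9
  have l5' := Real.log_five_lt_d9
  have hlog4 := log_four
  have hw : 75 / 7 ≤ 3 / u := by rw [le_div_iff₀ hu0]; linarith
  set w := 3 / u with hwdef
  have hwu : u = 3 / w := by rw [hwdef]; field_simp
  have hw0 : 0 < w := by linarith
  have hw1 : 0 < w - 1 := by linarith
  set v := w⁻¹ with hv
  have hv0 : 0 < v := inv_pos.2 hw0
  have hvu : v = u / 3 := by rw [hv, hwdef, inv_div]
  have hvw : v * w = 1 := inv_mul_cancel₀ hw0.ne'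
  have hz0 : 0 < w - 1 + v ^ 2 := by positivity
  refine ⟨w, w - 1 + v ^ 2, 1 / 4, by linarith, hz0, ?_, by norm_num, by norm_num, ?_⟩
  · -- `z ≤ w ^ 2` makes `v ^ 2 * (w ^ 4 - 1) = w ^ 2 - v ^ 2` large enough
    have h1 : v ^ 2 * w ^ 4 = w ^ 2 := by
      calc v ^ 2 * w ^ 4 = (v * w) ^ 2 * w ^ 2 := by ring
        _ = w ^ 2 := by rw [hvw]; ring
    have h2 : v ≤ 1 := by rw [hvu]; linarith
    nlinarith
  · have hF := one_sub_sq_le_sqrt hu0 hu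
    have hlogw0 : 0 ≤ Real.log w := Real.log_nonneg (by linarith)
    have hlogw : Real.log w ≤ 2.302586 + (3 / 10 / u - 1) := by
      have h1 := log_le_log_add (a := 10) (y := w) (by norm_num) hw0
      have h2 := log_smooth 1 0 1
      norm_num at h2
      have h3 : w / 10 = 3 / 10 / u := by rw [hwdef]; ring
      rw [h2, h3] at h1
      linarith
    have hz1 : Real.log (1 + (w - 1 + v ^ 2)) ≤ Real.log w + v ^ 3 := by
      have h1 := log_le_log_add (a := w) (y := 1 + (w - 1 + v ^ 2)) hw0 (by linarith)
      have h2 : (1 + (w - 1 + v ^ 2)) / w - 1 = v ^ 3 := by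
        rw [hv]; field_simp; ring
      rwa [h2] at h1
    have hz2 : Real.log w - u / (3 - u) ≤ Real.log (w - 1 + v ^ 2) := by
      have h1 := log_le_log_add (a := w - 1) (y := w) hw1 hw0
      have h2 : w / (w - 1) - 1 = u / (3 - u) := by
        have : 3 - u ≠ 0 := by linarith
        rw [hwdef]; field_simp; ring
      rw [h2] at h1
      have h3 : Real.log (w - 1) ≤ Real.log (w - 1 + v ^ 2) :=
        Real.log_le_log hw1 (by linarith [sq_nonneg v])
      linarith
    have hmain : 4 * Real.log w * (1 - 7 / 20 * u ^ 2) ≤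
        4 * Real.log w * √((1 - u) * (1 - Real.log (1 - u))) := by gcongr
    refine le_trans ?_ hmain
    have hfrac : u / (3 - u) ≤ u * (25 / 68) := by
      rw [div_le_iff₀ (by linarith)]
      nlinarith
    have hq : u ^ 2 * Real.log w ≤ u * (0.3 + 1.302586 * u) := by
      calc u ^ 2 * Real.log w ≤ u ^ 2 * (2.302586 + (3 / 10 / u - 1)) := by gcongr
        _ = u * (0.3 + 1.302586 * u) := by field_simp; ring
    have e5 := log_smooth (-2) 0 1
    have e6 := log_smooth (-2) 0 0
    norm_num at e5 e6
    have hlin : v ^ 3 ≤ u * (7 / 25) ^ 2 / 27 := by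
      rw [hvu]
      have : u * u ^ 2 ≤ u * (7 / 25) ^ 2 := by gcongr
      nlinarith
    unfold logRate
    norm_num
    rw [e5]
    nlinarith

/-- With `4` ghosts for each sample point, the exponent `4 * log w` beats the logarithmic rate
at the deviation `√(x * (1 - log x))`.
Up to `x = 18 / 25` three fixed choices of parameters, nearly optimal on their intervals, do. Here
`z` is the value with equality in the constraint, rounded up. Logarithms are estimated by those of
nearby products of powers of `2`, `3` and `5`. -/
lemma exists_logRate_le {x : ℝ} (hx0 : 1 / 15 ≤ x) (hx1 : x < 1) :
    ∃ w z s : ℝ, 27 / 16 ≤ w ∧ 0 < z ∧ w ^ 4 * (w - 1) ≤ z * (w ^ 4 - 1) ∧ 0 < s ∧ s ≤ 1 ∧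
      logRate z s x ≤ 4 * Real.log w * √(x * (1 - Real.log x)) := by
  have l2 := Real.log_two_gt_d9
  have l2' := Real.log_two_lt_d9
  have l3 := Real.log_three_gt_d9
  have l3' := Real.log_three_lt_d9
  have l5 := Real.log_five_gt_d9
  have l5' := Real.log_five_lt_d9
  have hlog4 := log_four
  rcases le_total x (1 / 5) with h | h
  · refine ⟨27 / 16, 157 / 200, 1 / 36, le_rfl, by norm_num, by norm_num, by norm_num,
      by norm_num, ?_⟩
    have e1 := log_smooth 0 (-1) (-1)
    have e2 := log_smooth 0 0 (-1)
    have e3 := log_smooth (-2) (-2) 0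
    have e4 := log_smooth (-4) 3 0
    have t1 := log_le_log_add (a := 81 / 80) (y := 1 + 1 / 36) (by norm_num) (by norm_num)
    have e5 := log_smooth (-4) 4 (-1)
    have t2 := log_le_log_add (a := 16 / 9) (y := 1 + 157 / 200) (by norm_num) (by norm_num)
    have e6 := log_smooth 4 (-2) 0
    have t3 := log_le_log_add (a := 32 / 25) (y := (157 / 200)⁻¹) (by norm_num) (by norm_num)
    have e7 := log_smooth 5 0 (-2)
    rw [Real.log_inv] at t3
    norm_num at e1 e2 e3 e4 e5 e6 e7 t1 t2 t3
    have := linear_le_sqrt_of_endpoints (a := 1 / 15) (b := 1 / 5) (fa := 0.497) (fb := 0.722)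
      (c₀ := logRate (157 / 200) (1 / 36) 0) (c₁ := -Real.log (1 / 36)) (x := x)
      (L := 4 * Real.log (27 / 16)) (by norm_num) (by norm_num)
      (by rw [e4]; linarith) (by norm_num; rw [e1]; linarith) (by norm_num; rw [e2]; linarith)
      (by unfold logRate; norm_num; rw [e3, e4]; linarith)
      (by unfold logRate; norm_num; rw [e3, e4]; linarith) hx0 h
    refine le_trans (le_of_eq ?_) this
    unfold logRate; ring
  rcases le_total x (9 / 25) with h' | h'
  · refine ⟨9 / 4, 1301 / 1000, 1 / 15, by norm_num, by norm_num, by norm_num, by norm_num,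
      by norm_num, ?_⟩
    have e1 := log_smooth 0 0 (-1)
    have e2 := log_smooth 0 2 (-2)
    have e3 := log_smooth 0 (-1) (-1)
    have e4 := log_smooth (-2) 2 0
    have e5 := log_smooth 4 (-1) (-1)
    have t2 := log_le_log_add (a := 288 / 125) (y := 1 + 1301 / 1000) (by norm_num) (by norm_num)
    have e6 := log_smooth 5 2 (-3)
    have t3 := log_le_log_add (a := 125 / 162) (y := (1301 / 1000)⁻¹) (by norm_num) (by norm_num)
    have e7 := log_smooth (-1) (-4) 3
    rw [Real.log_inv] at t3
    norm_num at e1 e2 e3 e4 e5 e6 e7 t2 t3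
    have := linear_le_sqrt_of_endpoints (a := 1 / 5) (b := 9 / 25) (fa := 0.722) (fb := 0.853)
      (c₀ := logRate (1301 / 1000) (1 / 15) 0) (c₁ := -Real.log (1 / 15)) (x := x)
      (L := 4 * Real.log (9 / 4)) (by norm_num) (by norm_num)
      (by rw [e4]; linarith) (by norm_num; rw [e1]; linarith) (by norm_num; rw [e2]; linarith)
      (by unfold logRate; norm_num; rw [e3, e4, e5]; linarith)
      (by unfold logRate; norm_num; rw [e3, e4, e5]; linarith) h h'
    refine le_trans (le_of_eq ?_) this
    unfold logRate; ring
  rcases le_total x (18 / 25) with h'' | h''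
  · refine ⟨9 / 2, 3509 / 1000, 1 / 8, by norm_num, by norm_num, by norm_num, by norm_num,
      by norm_num, ?_⟩
    have e1 := log_smooth 0 2 (-2)
    have e2 := log_smooth 1 2 (-2)
    have e3 := log_smooth (-3) 0 0
    have e4 := log_smooth (-1) 2 0
    have e5 := log_smooth (-3) 2 0
    have t2 := log_le_log_add (a := 9 / 2) (y := 1 + 3509 / 1000) (by norm_num) (by norm_num)
    have t3 := log_le_log_add (a := 125 / 432) (y := (3509 / 1000)⁻¹) (by norm_num) (by norm_num)
    have e7 := log_smooth (-4) (-3) 3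
    rw [Real.log_inv] at t3
    norm_num at e1 e2 e3 e4 e5 e7 t2 t3
    have := linear_le_sqrt_of_endpoints (a := 9 / 25) (b := 18 / 25) (fa := 0.853) (fb := 0.978)
      (c₀ := logRate (3509 / 1000) (1 / 8) 0) (c₁ := -Real.log (1 / 8)) (x := x)
      (L := 4 * Real.log (9 / 2)) (by norm_num) (by norm_num)
      (by rw [e4]; linarith) (by norm_num; rw [e1]; linarith) (by norm_num; rw [e2]; linarith)
      (by unfold logRate; norm_num; rw [e3, e4, e5]; linarith)
      (by unfold logRate; norm_num; rw [e3, e4, e5]; linarith) h' h''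
    refine le_trans (le_of_eq ?_) this
    unfold logRate; ring
  · have := exists_logRate_le_near_one (u := 1 - x) (by linarith) (by linarith)
    simpa only [sub_sub_cancel] using this

/-! ### The clustering gap -/

lemma expLoss_empirical {X Y : Type*} [Fintype Y] [MeasurableSpace X] [MeasurableSpace Y]
    {ℓ : stdSimplex ℝ Y → Y → ℝ} {h : X → stdSimplex ℝ Y}
    (hm : Measurable fun z : X × Y => ℓ (h z.1) z.2) {n : ℕ} (s : Fin n → X × Y) :
    expLoss ℓ (empirical s) h = (n : ℝ)⁻¹ * ∑ i, ℓ (h (s i).1) (s i).2 := by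
  unfold expLoss empirical
  rw [integral_smul_measure, integral_finsetSum_measure fun i _ =>
    integrable_dirac' hm.stronglyMeasurable (by finiteness)]
  simp only [integral_dirac' _ _ hm.stronglyMeasurable]
  simp

lemma expLoss_mem_Icc {X Y : Type*} [Fintype Y] [MeasurableSpace X] [MeasurableSpace Y]
    {ℓ : stdSimplex ℝ Y → Y → ℝ} (hℓ : ∀ v y, 0 ≤ ℓ v y ∧ ℓ v y ≤ 1) {h : X → stdSimplex ℝ Y}
    (hm : Measurable fun z : X × Y => ℓ (h z.1) z.2) (μ : Measure (X × Y))
    [IsProbabilityMeasure μ] : expLoss ℓ μ h ∈ Set.Icc (0 : ℝ) 1 := by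
  have hint : Integrable (fun z : X × Y => ℓ (h z.1) z.2) μ :=
    Integrable.of_bound hm.aestronglyMeasurable 1 (Filter.Eventually.of_forall fun z => by
      rw [Real.norm_eq_abs, abs_of_nonneg (hℓ _ _).1]; exact (hℓ _ _).2)
  refine ⟨integral_nonneg fun z => (hℓ _ _).1, ?_⟩
  calc expLoss ℓ μ h ≤ ∫ _z, (1 : ℝ) ∂μ :=
        integral_mono hint (integrable_const _) fun z => (hℓ _ _).2
    _ = 1 := by simp

lemma expLoss_empirical_mem_Icc {X Y : Type*} [Fintype Y] [MeasurableSpace X] [MeasurableSpace Y]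
    {ℓ : stdSimplex ℝ Y → Y → ℝ} (hℓ : ∀ v y, 0 ≤ ℓ v y ∧ ℓ v y ≤ 1) {h : X → stdSimplex ℝ Y}
    (hm : Measurable fun z : X × Y => ℓ (h z.1) z.2) {n : ℕ} (s : Fin n → X × Y) :
    expLoss ℓ (empirical s) h ∈ Set.Icc (0 : ℝ) 1 := by
  rw [expLoss_empirical hm]
  refine ⟨mul_nonneg (by positivity) (Finset.sum_nonneg fun i _ => (hℓ _ _).1), ?_⟩
  have h1 : ∑ i, ℓ (h (s i).1) (s i).2 ≤ n := by
    calc ∑ i, ℓ (h (s i).1) (s i).2 ≤ ∑ _i : Fin n, (1 : ℝ) :=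
          Finset.sum_le_sum fun i _ => (hℓ _ _).2
      _ = n := by simp
  calc (n : ℝ)⁻¹ * ∑ i, ℓ (h (s i).1) (s i).2 ≤ (n : ℝ)⁻¹ * n := by gcongr
    _ ≤ 1 := inv_mul_le_one

lemma iInf_mem_Icc {q : ℕ} (hq : 1 ≤ q) {a : Fin q → ℝ} (ha : ∀ i, a i ∈ Set.Icc (0 : ℝ) 1) :
    ⨅ i, a i ∈ Set.Icc (0 : ℝ) 1 := by
  have : Nonempty (Fin q) := ⟨⟨0, hq⟩⟩
  obtain ⟨i, hi⟩ := exists_eq_ciInf_of_finite (f := a)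
  rw [← hi]; exact ha i

lemma abs_clusterGap_le_one {X Y : Type*} [Fintype Y] [MeasurableSpace X] [MeasurableSpace Y]
    {p q : ℕ} (hq : 1 ≤ q) {ℓ : stdSimplex ℝ Y → Y → ℝ} (hℓ : ∀ v y, 0 ≤ ℓ v y ∧ ℓ v y ≤ 1)
    {m : Fin p → ℕ} (hM : 1 ≤ ∑ k, m k) {D : Fin p → Measure (X × Y)}
    [∀ k, IsProbabilityMeasure (D k)] (S : (k : Fin p) → Fin (m k) → X × Y)
    {h : Fin q → X → stdSimplex ℝ Y} (hm : ∀ i, Measurable fun z : X × Y => ℓ (h i z.1) z.2) :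
    |clusterGap ℓ m D S h| ≤ 1 := by
  have hM0 : (0 : ℝ) < (∑ j, m j : ℕ) := by exact_mod_cast hM
  unfold clusterGap
  calc _ ≤ ∑ k, |(m k : ℝ) / (∑ j, m j : ℕ) *
          ((⨅ i, expLoss ℓ (D k) (h i)) - ⨅ i, expLoss ℓ (empirical (S k)) (h i))| :=
        Finset.abs_sum_le_sum_abs _ _
    _ ≤ ∑ k, (m k : ℝ) / (∑ j, m j : ℕ) := by
        refine Finset.sum_le_sum fun k _ => ?_
        rw [abs_mul, abs_of_nonneg (by positivity)]
        refine mul_le_of_le_one_right (by positivity) ?_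
        have h1 := iInf_mem_Icc hq fun i => expLoss_mem_Icc hℓ (hm i) (D k)
        have h2 := iInf_mem_Icc hq fun i => expLoss_empirical_mem_Icc hℓ (hm i) (S k)
        rw [abs_le]
        constructor <;> linarith [h1.1, h1.2, h2.1, h2.2]
    _ = 1 := by
        rw [← Finset.sum_div]
        push_cast at hM0 ⊢
        exact div_self hM0.ne'

/-- Assigning to each client a cluster which is optimal for one of the two losses bounds the gap,
with either sign, by a difference for this assignment. -/
lemma exists_assignment_abs_clusterGap_le {X Y : Type*} [Fintype Y] [MeasurableSpace X]
    [MeasurableSpace Y] {p q : ℕ} (hq : 1 ≤ q) {ℓ : stdSimplex ℝ Y → Y → ℝ} {m : Fin p → ℕ}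
    (hM : 1 ≤ ∑ k, m k) (D : Fin p → Measure (X × Y)) (S : (k : Fin p) → Fin (m k) → X × Y)
    {h : Fin q → X → stdSimplex ℝ Y} (hm : ∀ i, Measurable fun z : X × Y => ℓ (h i z.1) z.2) :
    ∃ φ : Fin p → Fin q, ∃ b : Bool, (∑ j, m j : ℕ) * |clusterGap ℓ m D S h| ≤
      (if b then 1 else -1) * ∑ k, ∑ i, ((∫ z, ℓ (h (φ k) z.1) z.2 ∂(D k)) -
        ℓ (h (φ k) (S k i).1) (S k i).2) := by
  have : Nonempty (Fin q) := ⟨⟨0, hq⟩⟩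
  have hM0 : (0 : ℝ) < (∑ j, m j : ℕ) := by exact_mod_cast hM
  have hgap : (∑ j, m j : ℕ) * clusterGap ℓ m D S h = ∑ k, (m k : ℝ) *
      ((⨅ i, expLoss ℓ (D k) (h i)) - ⨅ i, expLoss ℓ (empirical (S k)) (h i)) := by
    unfold clusterGap
    rw [Finset.mul_sum]
    refine Finset.sum_congr rfl fun k _ => ?_
    rw [← mul_assoc, mul_div_cancel₀ _ hM0.ne']
  have hterm : ∀ (k : Fin p) (a : Fin q), ∑ i, ((∫ z, ℓ (h a z.1) z.2 ∂(D k)) -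
        ℓ (h a (S k i).1) (S k i).2) =
      (m k : ℝ) * (expLoss ℓ (D k) (h a) - expLoss ℓ (empirical (S k)) (h a)) := by
    intro k a
    rw [expLoss_empirical (hm a), Finset.sum_sub_distrib]
    rcases Nat.eq_zero_or_pos (m k) with h0 | h0
    · have : IsEmpty (Fin (m k)) := by rw [h0]; infer_instance
      simp [h0]
    · have : (m k : ℝ) ≠ 0 := by positivity
      rw [mul_sub, mul_inv_cancel_left₀ this]
      simp [expLoss]
  rcases le_total 0 (clusterGap ℓ m D S h) with h0 | h0
  · have hφ : ∀ k, ∃ a, expLoss ℓ (empirical (S k)) (h a) =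
        ⨅ i, expLoss ℓ (empirical (S k)) (h i) := fun k => exists_eq_ciInf_of_finite
    choose φ hφ using hφ
    refine ⟨φ, true, ?_⟩
    rw [abs_of_nonneg h0, hgap, if_pos rfl, one_mul]
    refine Finset.sum_le_sum fun k _ => ?_
    rw [hterm, hφ]
    have := ciInf_le (Set.finite_range fun i => expLoss ℓ (D k) (h i)).bddBelow (φ k)
    gcongr
  · have hφ : ∀ k, ∃ a, expLoss ℓ (D k) (h a) = ⨅ i, expLoss ℓ (D k) (h i) :=
      fun k => exists_eq_ciInf_of_finite
    choose φ hφ using hφ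
    refine ⟨φ, false, ?_⟩
    rw [abs_of_nonpos h0, mul_neg, hgap, if_neg (by simp), neg_one_mul]
    refine neg_le_neg (Finset.sum_le_sum fun k _ => ?_)
    rw [hterm, hφ]
    have := ciInf_le (Set.finite_range fun i => expLoss ℓ (empirical (S k)) (h i)).bddBelow (φ k)
    gcongr

/-- The union bound over the `q ^ p` assignments and the two signs. -/
theorem exists_measurableSet_clusterGap_le {X Y : Type*} [MeasurableSpace X] [Fintype Y]
    [MeasurableSpace Y] {ℓ : stdSimplex ℝ Y → Y → ℝ} (hℓ : ∀ v y, 0 ≤ ℓ v y ∧ ℓ v y ≤ 1)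
    {H : Set (X → stdSimplex ℝ Y)} {p q c : ℕ} (hq : 1 ≤ q) (hc : 1 ≤ c) {m : Fin p → ℕ}
    (hM : 1 ≤ ∑ k, m k) {D : Fin p → Measure (X × Y)} [∀ k, IsProbabilityMeasure (D k)]
    (hmeas : ∀ h ∈ H, Measurable fun z : X × Y => ℓ (h z.1) z.2)
    (hclass : IsMeasurableClass (lossClass ℓ H) D) {d : ℕ}
    (hd : ∀ B : Finset (X × Y), PseudoShatters (lossClass ℓ H) B → B.card ≤ d)
    {t : ℝ} (ht : 0 < t) {K : Fin p → ℝ}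
    (hK : ∀ k, SelectionBound (fun j : Fin (m k) × Option (Fin c) => t * ghostWeight c j.2) (K k))
    {s : ℝ} (hs0 : 0 < s) (hs1 : s ≤ 1) {ε δ : ℝ}
    (hδ0 : 0 ≤ δ) (hδ : 2 * (q : ℝ) ^ p * ((1 + s) ^ ((c + 1) * ∑ k, m k) / s ^ (d * q) * (∏ k, K k) *
      Real.exp (-(t * ((∑ k, m k : ℕ) * ε)))) ≤ δ) :
    ∃ E : Set ((k : Fin p) → Fin (m k) → X × Y), MeasurableSet E ∧
      1 - δ ≤ (sampleLaw m D).real E ∧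
      ∀ S ∈ E, ∀ h : Fin q → X → stdSimplex ℝ Y, (∀ i, h i ∈ H) →
        |clusterGap ℓ m D S h| ≤ ε := by
  have hM0 : (0 : ℝ) < (∑ j, m j : ℕ) := by exact_mod_cast hM
  rcases H.eq_empty_or_nonempty with hH | hH
  · refine ⟨Set.univ, MeasurableSet.univ, ?_, fun S _ h hh => ?_⟩
    · simp [hδ0]
    · exact absurd (hh ⟨0, hq⟩) (by simp [hH])
  have hF : ∀ f ∈ lossClass ℓ H, ∀ z, f z ∈ Set.Icc (0 : ℝ) 1 := by
    rintro _ ⟨h, -, rfl⟩ z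
    exact hℓ _ _
  have hFm : ∀ f ∈ lossClass ℓ H, Measurable f := by
    rintro _ ⟨h, hh, rfl⟩
    exact hmeas h hh
  have hne : (lossClass ℓ H).Nonempty := hH.image _
  have hK' : ∀ (b : Bool) (k : Fin p), SelectionBound
      (fun j : Fin (m k) × Option (Fin c) => ((if b then 1 else -1) * t) * ghostWeight c j.2)
        (K k) := by
    rintro (_ | _) k
    · have := (hK k).neg (by
        rw [Fintype.sum_prod_type]
        exact Finset.sum_eq_zero fun i _ => by rw [← Finset.mul_sum, sum_ghostWeight hc, mul_zero])
      simpa using this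
    · simpa using hK k
  have hbad := fun (φ : Fin p → Fin q) (b : Bool) =>
    exists_measurableSet_deviation_le hc hF hne hFm hclass hd φ (hK' b) hs0 hs1
      (t * ((∑ k, m k : ℕ) * ε))
  choose E hEm hEP hE using hbad
  set C := (1 + s) ^ ((c + 1) * ∑ k, m k) / s ^ (d * q) * (∏ k, K k) *
    Real.exp (-(t * ((∑ k, m k : ℕ) * ε))) with hC
  set U : Set ((k : Fin p) → Fin (m k) → X × Y) := ⋃ x : (Fin p → Fin q) × Bool, E x.1 x.2 with hU
  have hUm : MeasurableSet U := MeasurableSet.iUnion fun x => hEm x.1 x.2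
  have hUP : sampleLaw m D U ≤ ENNReal.ofReal δ := by
    calc sampleLaw m D U ≤ ∑ x : (Fin p → Fin q) × Bool, sampleLaw m D (E x.1 x.2) :=
          measure_iUnion_fintype_le _ _
      _ ≤ ∑ _x : (Fin p → Fin q) × Bool, ENNReal.ofReal C :=
          Finset.sum_le_sum fun x _ => hEP x.1 x.2
      _ = ENNReal.ofReal (2 * (q : ℝ) ^ p * C) := by
          rw [ENNReal.ofReal_mul (p := 2 * (q : ℝ) ^ p) (by positivity)]
          have h1 : ENNReal.ofReal (2 * (q : ℝ) ^ p) = ((q ^ p * 2 : ℕ) : ENNReal) := by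
            rw [← ENNReal.ofReal_natCast]; push_cast; rw [mul_comm]
          rw [h1]
          simp
      _ ≤ ENNReal.ofReal δ := ENNReal.ofReal_le_ofReal hδ
  refine ⟨Uᶜ, hUm.compl, ?_, fun S hS h hh => ?_⟩
  · rw [probReal_compl_eq_one_sub hUm]
    have : (sampleLaw m D).real U ≤ δ := ENNReal.toReal_le_of_le_ofReal hδ0 hUP
    linarith
  · obtain ⟨φ, b, hφ⟩ := exists_assignment_abs_clusterGap_le hq hM D S (fun i => hmeas _ (hh i))
    have hSE : S ∉ E φ b := fun hSE => hS (Set.mem_iUnion.2 ⟨(φ, b), hSE⟩)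
    have h1 := hE φ b S hSE (fun i z => ℓ (h i z.1) z.2) fun i => ⟨h i, hh i, rfl⟩
    rw [mul_comm (if b = true then (1 : ℝ) else -1) t, mul_assoc] at h1
    exact le_of_mul_le_mul_left (hφ.trans (le_of_mul_le_mul_left h1 ht)) hM0

lemma card_le_of_pseudoDim_eq {Z : Type*} {F : Set (Z → ℝ)} {d : ℕ} (hd : pseudoDim F = d)
    {B : Finset Z} (hB : PseudoShatters F B) : B.card ≤ d := by
  have h : ((B.card : ℕ) : ℕ∞) ≤ pseudoDim F :=
    le_iSup (fun A : {A : Finset Z // PseudoShatters F A} => (A.1.card : ℕ∞)) ⟨B, hB⟩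
  rw [hd] at h
  exact_mod_cast h

/-! ### Choice of parameters -/

lemma two_mul_pow_le {p q : ℕ} (hp : 1 ≤ p) (hq : 1 ≤ q) {δ : ℝ} (hδ0 : 0 < δ) (hδ1 : δ < 1) :
    2 * (q : ℝ) ^ p ≤ δ * Real.exp (p * Real.log (2 * q / δ)) := by
  have hq0 : (0 : ℝ) < q := by exact_mod_cast hq
  have h2 : 1 ≤ 2 / δ := by rw [le_div_iff₀ hδ0]; linarith
  rw [Real.exp_nat_mul, Real.exp_log (by positivity)]
  calc 2 * (q : ℝ) ^ p = δ * ((2 / δ) ^ 1 * (q : ℝ) ^ p) := by field_simp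
    _ ≤ δ * ((2 / δ) ^ p * (q : ℝ) ^ p) := by gcongr
    _ = δ * (2 * q / δ) ^ p := by rw [← mul_pow, div_mul_eq_mul_div]

lemma log_one_add_le_sqrt {y : ℝ} (hy : 0 ≤ y) : Real.log (y + 1) ≤ √y := by
  rw [Real.log_le_iff_le_exp (by linarith)]
  set v := √y with hv
  have hv0 : 0 ≤ v := Real.sqrt_nonneg y
  have hyv : y = v ^ 2 := (Real.sq_sqrt hy).symm
  have h := Real.sum_le_exp_of_nonneg hv0 4
  simp only [Finset.sum_range_succ, Finset.sum_range_zero, Nat.factorial] at h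
  norm_num at h
  rw [hyv]
  nlinarith [mul_nonneg hv0 (sq_nonneg (v - 3 / 2)), sq_nonneg v]

lemma sum_log_le_sqrt {p : ℕ} (m : Fin p → ℕ) :
    ∑ k, Real.log (5 * m k + 1) ≤ √(5 * (p * (∑ k, m k : ℕ))) := by
  calc ∑ k, Real.log (5 * m k + 1) ≤ ∑ k, √(5 * m k) :=
        Finset.sum_le_sum fun k _ => log_one_add_le_sqrt (by positivity)
    _ ≤ _ := by
        refine Real.le_sqrt_of_sq_le ((sq_sum_le_card_mul_sum_sq).trans_eq ?_)
        simp only [Finset.card_univ, Fintype.card_fin]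
        rw [Finset.sum_congr rfl fun k _ => Real.sq_sqrt (show (0 : ℝ) ≤ 5 * m k by positivity),
          ← Finset.mul_sum]
        push_cast
        ring

lemma subsets_factor_le {z : ℝ} (hz : 0 < z) (n : ℕ) :
    (1 + z) ^ ((4 + 1) * n) / (z ^ n * (((4 + 1) * n).choose n : ℝ)) ≤
      Real.exp (n * (5 * Real.log (1 + z) - Real.log z - (5 * Real.log 5 - 4 * Real.log 4)) +
        Real.log (5 * n + 1)) := by
  have h1z : 0 < 1 + z := by linarith
  have hC : (0 : ℝ) < (((4 + 1) * n).choose n : ℝ) := by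
    exact_mod_cast Nat.choose_pos (by omega)
  have hrw : Real.exp (n * (5 * Real.log (1 + z) - Real.log z -
      (5 * Real.log 5 - 4 * Real.log 4)) + Real.log (5 * n + 1)) =
      ((1 + z) ^ (5 * n) / (z ^ n * (3125 / 256) ^ n)) * (5 * n + 1) := by
    have h1 : 5 * Real.log (1 + z) - Real.log z - (5 * Real.log 5 - 4 * Real.log 4) =
        Real.log ((1 + z) ^ 5 / (z * (3125 / 256))) := by
      rw [Real.log_div (by positivity) (by positivity), Real.log_mul (by positivity) (by positivity),
        Real.log_pow, show (3125 / 256 : ℝ) = 5 ^ 5 / 4 ^ 4 by norm_num,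
        Real.log_div (by positivity) (by positivity), Real.log_pow, Real.log_pow]
      push_cast; ring
    rw [Real.exp_add, Real.exp_log (by positivity), h1, Real.exp_nat_mul,
      Real.exp_log (by positivity), div_pow, mul_pow, ← pow_mul]
  rw [hrw, div_mul_eq_mul_div, div_le_div_iff₀ (by positivity) (by positivity)]
  have h := pow_le_choose_five_mul n
  norm_num at h ⊢
  calc (1 + z) ^ (5 * n) * (z ^ n * (3125 / 256) ^ n)
      ≤ (1 + z) ^ (5 * n) * (z ^ n * ((5 * n + 1) * ((5 * n).choose n : ℝ))) := by gcongr
    _ = _ := by ring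

/-- Choice of the weight `s` in the Sauer–Shelah bound when the dimension `D` is small compared to
the sample size `N`. -/
lemma exists_weight {N D : ℝ} (hN : 1 ≤ N) (hD0 : 0 ≤ D) (hDN : D ≤ N) :
    ∃ s : ℝ, 0 < s ∧ s ≤ 1 ∧ 12 * N * Real.log (1 + s) - D * Real.log s ≤
      1 / 2 + D * (1 - Real.log (D / N) + Real.log 12) := by
  rcases hD0.eq_or_lt with h0 | h0
  · subst h0
    refine ⟨1 / (24 * N), by positivity, (div_le_one (by positivity)).2 (by linarith), ?_⟩
    have h := Real.log_le_sub_one_of_pos (show 0 < 1 + 1 / (24 * N) by positivity)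
    calc 12 * N * Real.log (1 + 1 / (24 * N)) - 0 * Real.log (1 / (24 * N))
        ≤ 12 * N * (1 + 1 / (24 * N) - 1) - 0 := by rw [zero_mul]; gcongr
      _ = 1 / 2 + 0 * (1 - Real.log (0 / N) + Real.log 12) := by field_simp; ring
  · refine ⟨D / (12 * N), by positivity, (div_le_one (by positivity)).2 (by linarith), ?_⟩
    have h := Real.log_le_sub_one_of_pos (show 0 < 1 + D / (12 * N) by positivity)
    have h1 : 12 * N * Real.log (1 + D / (12 * N)) ≤ D := by
      calc 12 * N * Real.log (1 + D / (12 * N)) ≤ 12 * N * (1 + D / (12 * N) - 1) := by gcongr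
        _ = D := by field_simp; ring
    have h2 : Real.log (D / (12 * N)) = Real.log (D / N) - Real.log 12 := by
      rw [← Real.log_div (by positivity) (by norm_num)]
      congr 1; field_simp
    rw [h2]
    linarith

/-- The exponent for few dimensions. The choice of `t` minimizes the quadratic polynomial that
Hoeffding's lemma gives with `11` ghosts for each sample point. -/
lemma exponent_nonpos_of_few_dims {N A x L α β s t : ℝ} (hN : 1 ≤ N) (hA : 1 / 2 ≤ A)
    (hα0 : 0 ≤ α) (hβ0 : 0 ≤ β) (hα : N * α ^ 2 = 4 * A) (hβ : β ^ 2 = x * L) (hx0 : 0 ≤ x)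
    (hx : x < 1 / 15) (hxL : x * (1 - Real.log x) ≤ x * L)
    (hs : 12 * N * Real.log (1 + s) - N * x * Real.log s ≤
      1 / 2 + N * x * (1 - Real.log x + Real.log 12)) (ht : t = 121 / 36 * (α + β)) :
    A + (12 * N * Real.log (1 + s) - N * x * Real.log s + N * ((t * (12 / 11)) ^ 2 / 8) -
      t * (N * (α + β))) ≤ 0 := by
  have hN0 : 0 ≤ N := by linarith
  have hsq : 4 * A + N * (x * L) ≤ N * (α + β) ^ 2 := by
    rw [← hα, ← hβ]
    nlinarith [mul_nonneg (mul_nonneg hN0 hα0) hβ0]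
  have h3 : N * (x * (1 - Real.log x)) ≤ N * (x * L) := mul_le_mul_of_nonneg_left hxL hN0
  have hlog : N * x * Real.log 12 ≤ 49 / 72 * (N * (x * L)) := by
    rcases hx0.eq_or_lt with h0 | h0
    · simp [← h0]
    have h1 : Real.log 12 ≤ 49 / 72 * (1 - Real.log x) := by
      have h15 : Real.log x ≤ Real.log (1 / 15) := Real.log_le_log h0 hx.le
      have e1 := log_smooth 0 (-1) (-1)
      have e2 := log_smooth 2 1 0
      norm_num at e1 e2 h15
      rw [e2]
      linarith [Real.log_two_gt_d9, Real.log_two_lt_d9, Real.log_three_gt_d9,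
        Real.log_three_lt_d9, Real.log_five_gt_d9]
    have h2 : N * x * Real.log 12 ≤ N * x * (49 / 72 * (1 - Real.log x)) :=
      mul_le_mul_of_nonneg_left h1 (by positivity)
    linarith
  have h4 : N * ((t * (12 / 11)) ^ 2 / 8) - t * (N * (α + β)) =
      -(121 / 72 * (N * (α + β) ^ 2)) := by rw [ht]; ring
  linarith

/-- The exponent for many dimensions: the rate is beaten by the summand `β` of the deviation, and
the remaining terms by the summand `α`. -/
lemma exponent_nonpos_of_many_dims {p : ℕ} {m : Fin p → ℕ} {N A x L α β z s t : ℝ}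
    (hm : ((∑ k, m k : ℕ) : ℝ) = N) (hA : Real.log 2 * p ≤ A)
    (hα0 : 0 ≤ α) (hα1 : α ≤ 1) (hα : N * α ^ 2 = 4 * A) (hβ : β = √(x * L))
    (hxL : x * (1 - Real.log x) ≤ x * L) (ht : 2 ≤ t)
    (hr : logRate z s x ≤ t * √(x * (1 - Real.log x))) :
    A + N * logRate z s x + ∑ k, Real.log (5 * m k + 1) - t * (N * (α + β)) ≤ 0 := by
  have hN0 : 0 ≤ N := by rw [← hm]; positivity
  have hrate : N * logRate z s x ≤ t * (N * β) := by
    have h1 : √(x * (1 - Real.log x)) ≤ β := hβ ▸ Real.sqrt_le_sqrt hxL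
    calc N * logRate z s x ≤ N * (t * √(x * (1 - Real.log x))) := by gcongr
      _ ≤ N * (t * β) := by gcongr
      _ = t * (N * β) := by ring
  have hpoly : ∑ k, Real.log (5 * m k + 1) ≤ 3 / 2 * (N * α) := by
    refine (sum_log_le_sqrt m).trans (Real.sqrt_le_iff.2 ⟨by positivity, ?_⟩)
    rw [hm]
    have hpN : (0 : ℝ) ≤ p * N := by positivity
    calc (5 * (p * N) : ℝ) ≤ 9 * (Real.log 2 * p) * N := by
          nlinarith [Real.log_two_gt_d9]
      _ ≤ 9 * A * N := by gcongr
      _ = (3 / 2 * (N * α)) ^ 2 := by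
        rw [show (3 / 2 * (N * α)) ^ 2 = 9 / 4 * N * (N * α ^ 2) by ring, hα]; ring
  have hA4 : A ≤ 1 / 4 * (N * α) := by
    have : N * α ^ 2 ≤ N * α := by nlinarith [mul_nonneg hN0 hα0]
    linarith
  have hNα : 0 ≤ N * α := by positivity
  have hta : 2 * (N * α) ≤ t * (N * α) := by gcongr
  linarith

lemma exp_add_mul_exp_neg_le {w z : ℝ} (hw : 0 < w) (hwz : w ^ 4 * (w - 1) ≤ z * (w ^ 4 - 1)) :
    Real.exp (4 * Real.log w / (4 : ℕ)) + z * Real.exp (-(4 * Real.log w)) ≤ 1 + z := by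
  have h1 : Real.exp (4 * Real.log w / (4 : ℕ)) = w := by
    push_cast
    rw [mul_div_cancel_left₀ _ (by norm_num : (4 : ℝ) ≠ 0), Real.exp_log hw]
  have h2 : Real.exp (-(4 * Real.log w)) = (w ^ 4)⁻¹ := by
    rw [Real.exp_neg, show 4 * Real.log w = Real.log (w ^ 4) by rw [Real.log_pow]; norm_num,
      Real.exp_log (by positivity)]
  rw [h1, h2, ← mul_le_mul_iff_left₀ (show 0 < w ^ 4 by positivity), add_mul, mul_assoc,
    inv_mul_cancel₀ (by positivity)]
  linarith

lemma two_le_four_mul_log {w : ℝ} (hw : 27 / 16 ≤ w) : 2 ≤ 4 * Real.log w := by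
  have h1 : Real.log (27 / 16) ≤ Real.log w := Real.log_le_log (by norm_num) hw
  have e := log_smooth (-4) 3 0
  norm_num at e
  linarith [Real.log_two_lt_d9, Real.log_three_gt_d9]

end ClusterGen

end

open ClusterGen in
theorem corollary1 {X Y : Type*} [MeasurableSpace X] [Fintype Y] [MeasurableSpace Y]
    [MeasurableSingletonClass Y]
    -- loss with values in `[0, 1]`, hypothesis class
    (ℓ : stdSimplex ℝ Y → Y → ℝ) (hℓ : ∀ v y, 0 ≤ ℓ v y ∧ ℓ v y ≤ 1)
    (H : Set (X → stdSimplex ℝ Y))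
    -- clients, sample sizes, distributions, number of clusters
    (p q : ℕ) (hq : 1 ≤ q) (m : Fin p → ℕ) (M : ℕ) (hM : M = ∑ k, m k) (hMpos : 1 ≤ M)
    (D : Fin p → MeasureTheory.Measure (X × Y))
    [∀ k, MeasureTheory.IsProbabilityMeasure (D k)]
    -- measurability
    (hmeas : ∀ h ∈ H, Measurable fun z : X × Y => ℓ (h z.1) z.2)
    (hclass : ClusterGen.IsMeasurableClass (ClusterGen.lossClass ℓ H) D)
    -- pseudo-dimension
    (d : ℕ) (hd : ClusterGen.pseudoDim (ClusterGen.lossClass ℓ H) = d) (hdM : d ≤ M)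
    (δ : ℝ) (hδ0 : 0 < δ) (hδ1 : δ < 1) :
    ∃ E : Set ((k : Fin p) → Fin (m k) → X × Y), MeasurableSet E ∧
      1 - δ ≤ (ClusterGen.sampleLaw m D).real E ∧
      ∀ S ∈ E, ∀ h : Fin q → X → stdSimplex ℝ Y, (∀ i, h i ∈ H) →
        |ClusterGen.clusterGap ℓ m D S h| ≤
          √(4 * p * Real.log (2 * q / δ) / M) +
            √(d * q / M * Real.log (Real.exp 1 * M / d)) := by
  have hM1 : 1 ≤ ∑ k, m k := hM ▸ hMpos
  have hp : 1 ≤ p := by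
    rcases Nat.eq_zero_or_pos p with h | h
    · subst h; simp at hM1
    · exact h
  have hN1 : (1 : ℝ) ≤ M := by exact_mod_cast hMpos
  have hN0 : (0 : ℝ) < M := by linarith
  have hp1 : (1 : ℝ) ≤ p := by exact_mod_cast hp
  have hq1 : (1 : ℝ) ≤ q := by exact_mod_cast hq
  have hd' : ∀ B : Finset (X × Y), PseudoShatters (lossClass ℓ H) B → B.card ≤ d :=
    fun B hB => card_le_of_pseudoDim_eq hd hB
  set A : ℝ := p * Real.log (2 * q / δ) with hA
  set L : ℝ := Real.log (Real.exp 1 * M / d) with hL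
  set α := √(4 * p * Real.log (2 * q / δ) / M) with hα
  set β := √(d * q / M * L) with hβ
  have hlog2 : Real.log 2 ≤ Real.log (2 * q / δ) := by
    refine Real.log_le_log (by norm_num) ?_
    rw [le_div_iff₀ hδ0]
    nlinarith
  have l2 := Real.log_two_gt_d9
  have hAp : Real.log 2 * p ≤ A := by rw [hA, mul_comm]; gcongr
  have hA1 : 0.69 ≤ A := by nlinarith
  have hα0 : 0 ≤ α := Real.sqrt_nonneg _
  have hβ0 : 0 ≤ β := Real.sqrt_nonneg _
  have hα2 : M * α ^ 2 = 4 * A := by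
    rw [hα, Real.sq_sqrt (by rw [mul_assoc, ← hA]; positivity), hA]; field_simp
  rcases le_or_gt 1 (α + β) with hε | hε
  · exact ⟨Set.univ, MeasurableSet.univ, by simp [hδ0.le], fun S _ h hh =>
      (abs_clusterGap_le_one hq hℓ hM1 S fun i => hmeas _ (hh i)).trans hε⟩
  have hα1 : α < 1 := by linarith
  have hβ1 : β < 1 := by linarith
  set x : ℝ := d * q / M with hx
  have hx0 : 0 ≤ x := by positivity
  -- the logarithmic factor of the bound dominates the one for all clusters together
  have hxL : x * (1 - Real.log x) ≤ x * L ∧ x ≤ x * L := by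
    rcases Nat.eq_zero_or_pos d with h0 | h0
    · simp [hx, h0]
    · have hd0 : (0 : ℝ) < d := by exact_mod_cast h0
      have hdM' : (d : ℝ) ≤ M := by exact_mod_cast hdM
      have h1 : L = 1 + Real.log (M / d) := by
        rw [hL, mul_div_assoc, Real.log_mul (Real.exp_pos 1).ne' (by positivity), Real.log_exp]
      have h2 : 0 ≤ Real.log (M / d) := Real.log_nonneg ((one_le_div hd0).2 hdM')
      have h3 : -Real.log x ≤ Real.log (M / d) := by
        rw [← Real.log_inv]
        refine Real.log_le_log (by positivity) ?_
        rw [hx, inv_div, div_le_div_iff₀ (by positivity) hd0]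
        nlinarith [mul_pos hd0 hN0]
      constructor
      · exact mul_le_mul_of_nonneg_left (by linarith) hx0
      · exact le_mul_of_one_le_right hx0 (by linarith)
  have hβ2 : β ^ 2 = x * L := Real.sq_sqrt (hx0.trans hxL.2)
  have hx1 : x < 1 := by
    have : β ^ 2 < 1 := by nlinarith
    linarith [hxL.2]
  have hpow := two_mul_pow_le hp hq hδ0 hδ1
  rw [← hA] at hpow
  have hMx : (M : ℝ) * x = d * q := by rw [hx]; field_simp
  have hlevel : ∀ (c : ℕ) {s : ℝ}, 0 < s → (1 + s) ^ ((c + 1) * ∑ k, m k) / s ^ (d * q) =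
      Real.exp ((c + 1) * M * Real.log (1 + s) - M * x * Real.log s) := by
    intro c s hs
    rw [Real.exp_sub, hMx]
    have h1 : ((c : ℝ) + 1) * M = (((c + 1) * ∑ k, m k : ℕ) : ℝ) := by rw [← hM]; push_cast; ring
    have h2 : (d : ℝ) * q = ((d * q : ℕ) : ℝ) := by push_cast; ring
    rw [h1, h2, Real.exp_nat_mul, Real.exp_nat_mul, Real.exp_log (by linarith), Real.exp_log hs]
  have hMsum : ∀ a : ℝ, ∑ k, (m k : ℝ) * a = M * a := by
    intro a; rw [← Finset.sum_mul, hM]; push_cast; rfl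
  rcases lt_or_ge x (1 / 15) with hx15 | hx15
  · -- few dimensions: Hoeffding's lemma with `11` ghosts for each sample point
    obtain ⟨s, hs0, hs1, hs⟩ := exists_weight (N := M) (D := M * x) hN1 (by positivity)
      (by nlinarith)
    rw [mul_div_cancel_left₀ x hN0.ne'] at hs
    have hε0 : 0 < α + β := by
      have : 0 < α := by
        refine lt_of_le_of_ne hα0 fun h => ?_
        rw [← h] at hα2; linarith
      linarith
    set t := 121 / 36 * (α + β) with ht
    have ht0 : 0 < t := by positivity
    refine exists_measurableSet_clusterGap_le hℓ hq (c := 11) (by norm_num) hM1 hmeas hclass hd' ht0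
      (fun k => selectionBound_rows (by norm_num) (m k) ht0.le) hs0 hs1 hδ0.le ?_
    rw [hlevel 11 hs0, ← Real.exp_sum, hMsum, ← hM, ← Real.exp_add, ← Real.exp_add]
    calc 2 * (q : ℝ) ^ p * Real.exp _ ≤ δ * Real.exp A * Real.exp _ := by gcongr
      _ = δ * Real.exp _ := by rw [mul_assoc, ← Real.exp_add]
      _ ≤ δ * 1 := by
        gcongr
        rw [Real.exp_le_one_iff]
        have := exponent_nonpos_of_few_dims hN1 (by linarith) hα0 hβ0 hα2 hβ2 hx0 hx15 hxL.1 hs ht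
        refine le_trans (le_of_eq ?_) this
        push_cast; ring
      _ = δ := mul_one δ
  · -- many dimensions: exact counting of selections with `4` ghosts for each sample point
    obtain ⟨w, z, s, hw, hz, hwz, hs0, hs1, hrate⟩ := exists_logRate_le hx15 hx1
    have hw2 := two_le_four_mul_log hw
    have hsel := exp_add_mul_exp_neg_le (by linarith) hwz
    set t := 4 * Real.log w with ht
    have ht0 : 0 < t := by linarith
    refine exists_measurableSet_clusterGap_le hℓ hq (c := 4) (by norm_num) hM1 hmeas hclass hd' ht0
      (fun k => selectionBound_subsets (by norm_num) (m k) hz hsel) hs0 hs1 hδ0.le ?_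
    have hprod := Finset.prod_le_prod (s := Finset.univ) (fun k _ => by positivity)
      fun k _ => subsets_factor_le hz (m k)
    rw [← Real.exp_sum, Finset.sum_add_distrib, hMsum] at hprod
    rw [hlevel 4 hs0, ← hM]
    refine (mul_le_mul hpow (mul_le_mul_of_nonneg_right
      (mul_le_mul_of_nonneg_left hprod (Real.exp_pos _).le) (Real.exp_pos _).le)
      (by positivity) (by positivity)).trans ?_
    rw [← Real.exp_add, ← Real.exp_add, mul_assoc, ← Real.exp_add]
    refine (mul_le_mul_of_nonneg_left ?_ hδ0.le).trans_eq (mul_one δ)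
    rw [Real.exp_le_one_iff]
    have := exponent_nonpos_of_many_dims (by rw [← hM]) hAp hα0 hα1.le hα2 rfl hxL.1 hw2 hrate
    refine le_trans (le_of_eq ?_) this
    unfold logRate
    push_cast; ring
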